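/- **Model.** A hidden marked point process on $[0,T]$ has points arriving at rate $\nu>0$, with independent exponential marks of mean $\gamma>0$. For $a<b$ let $E_{(a,b]}=\bigcup_{k\ge0}\{k\}\times\{a<\phi_1<\dots<\phi_k\le b\}\times(0,\infty)^k$ be the space of configurations on $(a,b]$, with dominating measure $dx$ (counting measure in $k$, Lebesgue measure in times and marks), and let $\mathsf p$ be the prior density on $E_{(a,b]}$: $k$ is Poisson with mean $\nu(b-a)$, the ordered times are uniform given $k$, and the marks are independent exponential. Let $\lambda_u(x)\ge0$ be a jointly measurable intensity which is integrable in $u$ on bounded intervals and depends only on the points of $x$ in $[0,u]$; for example the shot-noise process $\lambda_u(x)=\lambda_0e^{-su}+\sum_{j:\phi_j\le u}\zeta_je^{-s(u-\phi_j)}$. Given observed events at times $0<\omega_1<\dots<\omega_r<T$ with real marks $\xi_1,\dots,\xi_r$, put $$l_{(a,b]}(x)=\prod_{i:\,a<\omega_i\le b}\tilde p(\xi_i;\mu,\sigma)\,\lambda_{\omega_i}(x)\;\exp\Big\{-\int_a^b\lambda_u(x)\,du\Big\},$$ where $\tilde p(\cdot;\mu,\sigma)$ is the density of the $t$-distribution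 with one degree of freedom, location $\mu$ and scale $\sigma>0$ (both known). Let $0=t_0<t_1<\dots<t_M\le T$, let $\bar E_n=E_{(0,t_n]}$, and identify $\bar E_n$ with $\bar E_{n-1}\times E_{(t_{n-1},t_n]}$, writing $\bar x_n=(\bar x_{n-1},\bar x_{n,1})$. The posterior $\pi_n$ on $\bar E_n$ is the probability measure with density proportional to $l_{(0,t_n]}(\bar x_n)\,\mathsf p(\bar x_n)$; its normalising constant is assumed to lie in $(0,\infty)$ for $1\le n\le M$. For $n\ge2$ let $$g_n(\bar x_n)=l_{(t_{n-1},t_n]}(\bar x_n)\,\mathsf p(\bar x_{n,1})/p_n,\qquad p_n=\iint l_{(t_{n-1},t_n]}(\bar x_n)\,\mathsf p(\bar x_{n,1})\,d\bar x_{n,1}\,\pi_{n-1}(d\bar x_{n-1}).$$ **Algorithm.** Fix $N\ge1$. For $\chi=(\chi^{(1)},\dots,\chi^{(N)})\in\bar E_{n-1}^N$ let $S_\chi=\frac1N\sum_i\delta_{\chi^{(i)}}$. Let $K_1$ be a Markov kernel on $\bar E_1$ with invariant distribution $\pi_1$ and, for $2\le n\le M$, let $K_{\chi,n}$ be a Markov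 kernel on $\bar E_n$, measurable in $\chi$, whose invariant distribution is the normalisation of $l_{(t_{n-1},t_n]}(\bar x_n)\,\mathsf p(\bar x_{n,1})\,d\bar x_{n,1}\,S_\chi(d\bar x_{n-1})$ (for example a reversible jump MCMC kernel). At step $1$, $\bar X_1^{(1)},\dots,\bar X_1^{(N)}$ is a Markov chain with kernel $K_1$ started at an arbitrary point $\bar x_1^{(1)}\in\bar E_1$. At step $n\ge2$, given the samples $\chi=(\bar X_{n-1}^{(1)},\dots,\bar X_{n-1}^{(N)})$ of the previous step, $\bar X_n^{(1)}$ is drawn from $S_\chi\otimes\mathsf p(\bar x_{n,1})\,d\bar x_{n,1}$ and $\bar X_n^{(1)},\dots,\bar X_n^{(N)}$ is a Markov chain with kernel $K_{\chi,n}$. **Assumption (A).** (i) There are $\epsilon_1\in(0,1)$ and a probability measure $\kappa_1$ on $\bar E_1$ with $K_1(x,\cdot)\ge\epsilon_1\kappa_1(\cdot)$ for all $x\in\bar E_1$. (ii) For $2\le n\le M$ there are $\epsilon_n\in(0,1)$ and a probability measure $\kappa_n$ on $E_{(t_{n-1},t_n]}$ with $K_{\chi,n}(x,\cdot)\ge\epsilon_n\,(S_\chi\otimes\kappa_n)(\cdot)$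 for all $N\ge1$, $\chi\in\bar E_{n-1}^N$, $x\in\bar E_n$. (iii) For $2\le n\le M$, $\sup_{\bar x_{n-1}\in\bar E_{n-1}}\int g_n(\bar x_{n-1},\bar x_{n,1})\,d\bar x_{n,1}<\infty$. **Proposition.** Assume (A). Then for every $1\le n\le M$ and every real $p\ge1$ there is a constant $B_{p,n}<\infty$ (which may depend on the data, the model and the kernels, but not on $N$, $\bar x_1^{(1)}$ or $f_n$) such that for all $N\ge1$, all $\bar x_1^{(1)}\in\bar E_1$ and all bounded measurable $f_n:\bar E_n\to\mathbb R$, $$\mathbb E_{\bar x_1^{(1)}}\Big[\Big|\frac1N\sum_{i=1}^Nf_n(\bar X_n^{(i)})-\int_{\bar E_n}f_n\,d\pi_n\Big|^p\Big]^{1/p}\le\frac{B_{p,n}\,\|f_n\|}{\sqrt N},\qquad\|f_n\|=\sup_{x\in\bar E_n}|f_n(x)|,$$ where the expectation is over the algorithm, given the observed data. -/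

import Mathlib

open MeasureTheory ProbabilityTheory
open scoped ENNReal NNReal

noncomputable section

namespace PPFilter

/-! ### Configurations of marked points -/

/-- A finite list of marked points on the line: the number `k` of points, their times
`φ_1, …, φ_k` and their marks `ζ_1, …, ζ_k`. -/
abbrev MarkedPoints : Type := Σ k : ℕ, (Fin k → ℝ) × (Fin k → ℝ)

namespace MarkedPoints

/-- The number of points. -/
abbrev count (x : MarkedPoints) : ℕ := x.1

/-- The times of the points. -/
abbrev times (x : MarkedPoints) : Fin x.count → ℝ := x.2.1

/-- The marks of the points. -/
abbrev marks (x : MarkedPoints) : Fin x.count → ℝ := x.2.2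

/-- The points of `x`, followed by the points of `x'`. -/
def append (x x' : MarkedPoints) : MarkedPoints :=
  ⟨x.1 + x'.1, Fin.append x.2.1 x'.2.1, Fin.append x.2.2 x'.2.2⟩

/-- The `k` points with times `p.1` and marks `p.2`. -/
def layer (k : ℕ) (p : (Fin k → ℝ) × (Fin k → ℝ)) : MarkedPoints := ⟨k, p⟩

lemma injective_layer (k : ℕ) : Function.Injective (layer k) :=
  sigma_mk_injective (β := fun k : ℕ => (Fin k → ℝ) × (Fin k → ℝ))

lemma measurableSet_iff {s : Set MarkedPoints} :
    MeasurableSet s ↔ ∀ k, MeasurableSet (layer k ⁻¹' s) :=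
  MeasurableSpace.measurableSet_iInf

lemma measurableEmbedding_layer (k : ℕ) : MeasurableEmbedding (layer k) := by
  refine ⟨injective_layer k, fun _ hs => measurableSet_iff.1 hs k, fun {t} ht => ?_⟩
  rw [measurableSet_iff]
  intro l
  by_cases hkl : l = k
  · subst hkl
    have h : layer l ⁻¹' (layer l '' t) = t := Set.preimage_image_eq _ (injective_layer l)
    rwa [h]
  · have h : layer l ⁻¹' (layer k '' t) = ∅ := by
      refine Set.eq_empty_of_forall_notMem ?_
      rintro p ⟨q, _, hq⟩
      exact hkl (congrArg Sigma.fst hq).symm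
    rw [h]
    exact .empty

lemma measurable_append : Measurable fun z : MarkedPoints × MarkedPoints => z.1.append z.2 := by
  intro A hA
  have h : ∀ k l : ℕ, Measurable
      fun q : ((Fin k → ℝ) × (Fin k → ℝ)) × ((Fin l → ℝ) × (Fin l → ℝ)) =>
        (layer k q.1).append (layer l q.2) := by
    intro k l
    refine (measurableEmbedding_layer (k + l)).measurable.comp (g := layer (k + l))
      (f := fun q : ((Fin k → ℝ) × (Fin k → ℝ)) × ((Fin l → ℝ) × (Fin l → ℝ)) =>
        (Fin.append q.1.1 q.2.1, Fin.append q.1.2 q.2.2)) ?_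
    refine Measurable.prodMk (measurable_pi_lambda _ fun j => ?_)
      (measurable_pi_lambda _ fun j => ?_)
    all_goals
      induction j using Fin.addCases with
      | left j => simp only [Fin.append_left]; fun_prop
      | right j => simp only [Fin.append_right]; fun_prop
  have h2 : (fun z : MarkedPoints × MarkedPoints => z.1.append z.2) ⁻¹' A =
      ⋃ k : ℕ, ⋃ l : ℕ, Prod.map (layer k) (layer l) ''
        ((fun q => (layer k q.1).append (layer l q.2)) ⁻¹' A) := by
    ext ⟨⟨k, p⟩, ⟨l, p'⟩⟩
    simp only [Set.mem_preimage, Set.mem_iUnion, Set.mem_image]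
    constructor
    · intro h
      exact ⟨k, l, (p, p'), h, rfl⟩
    · rintro ⟨k', l', q, h, hq⟩
      have h' : (layer k' q.1).append (layer l' q.2) = append ⟨k, p⟩ ⟨l, p'⟩ :=
        congrArg (fun z : MarkedPoints × MarkedPoints => z.1.append z.2) hq
      exact Set.mem_of_eq_of_mem h'.symm h
  rw [h2]
  exact .iUnion fun k => .iUnion fun l =>
    ((measurableEmbedding_layer k).prodMap (measurableEmbedding_layer l)).measurableSet_image.2
      (h k l hA)

/-- The Lebesgue measure on marked points: on each set `{k} × ℝ^k × ℝ^k` it is the Lebesgue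
measure, and the different values of `k` are summed. -/
def lebesgue : Measure MarkedPoints :=
  Measure.sum fun k : ℕ =>
    (volume : Measure ((Fin k → ℝ) × (Fin k → ℝ))).map (layer k)

instance : SFinite lebesgue := by
  unfold lebesgue
  infer_instance

end MarkedPoints

/-- The marked points `x` form a configuration on `(a, b]`: the times are ordered and lie in
`(a, b]`, and the marks are positive. -/
def IsConfig (a b : ℝ) (x : MarkedPoints) : Prop :=
  StrictMono x.times ∧ (∀ j, a < x.times j ∧ x.times j ≤ b) ∧ ∀ j, 0 < x.marks j

lemma IsConfig.append {a b c : ℝ} (hab : a ≤ b) (hbc : b ≤ c) {x x' : MarkedPoints}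
    (hx : IsConfig a b x) (hx' : IsConfig b c x') : IsConfig a c (x.append x') := by
  obtain ⟨k, φ, ζ⟩ := x
  obtain ⟨l, φ', ζ'⟩ := x'
  obtain ⟨h₁, h₂, h₃⟩ := hx
  obtain ⟨h₁', h₂', h₃'⟩ := hx'
  refine ⟨?_, ?_, ?_⟩
  · change StrictMono (Fin.append φ φ')
    intro i j
    induction i using Fin.addCases with
    | left i =>
      induction j using Fin.addCases with
      | left j =>
        intro hij
        simp only [Fin.append_left]
        exact h₁ (show i.val < j.val from hij)
      | right j =>
        intro _
        simp only [Fin.append_left, Fin.append_right]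
        exact (h₂ i).2.trans_lt (h₂' j).1
    | right i =>
      induction j using Fin.addCases with
      | left j =>
        intro hij
        have h : k + i.val < j.val := hij
        have := j.2
        omega
      | right j =>
        intro hij
        simp only [Fin.append_right]
        have h : k + i.val < k + j.val := hij
        exact h₁' (show i.val < j.val by omega)
  · change ∀ j, a < Fin.append φ φ' j ∧ Fin.append φ φ' j ≤ c
    intro j
    induction j using Fin.addCases with
    | left j =>
      simp only [Fin.append_left]
      exact ⟨(h₂ j).1, (h₂ j).2.trans hbc⟩
    | right j =>
      simp only [Fin.append_right]
      exact ⟨hab.trans_lt (h₂' j).1, (h₂' j).2⟩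
  · change ∀ j, 0 < Fin.append ζ ζ' j
    intro j
    induction j using Fin.addCases with
    | left j => simpa only [Fin.append_left] using h₃ j
    | right j => simpa only [Fin.append_right] using h₃' j

/-- The space `⋃_k {k} × Φ_{k,(a,b]} × (0, ∞)^k` of the configurations on `(a, b]`, where
`Φ_{k,(a,b]} = {a < φ_1 < ⋯ < φ_k ≤ b}`. -/
abbrev Config (a b : ℝ) : Type := {x : MarkedPoints // IsConfig a b x}

namespace Config

variable {a b c : ℝ}

/-- The underlying marked points. -/
abbrev points (x : Config a b) : MarkedPoints := x.1

lemma measurable_points : Measurable (points : Config a b → MarkedPoints) :=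
  measurable_subtype_coe

lemma measurableSet_isConfig (a b : ℝ) : MeasurableSet {x | IsConfig a b x} := by
  rw [MarkedPoints.measurableSet_iff]
  intro k
  have h : MarkedPoints.layer k ⁻¹' {x | IsConfig a b x} =
      (⋂ i, ⋂ j, ⋂ (_ : i < j), {p | p.1 i < p.1 j}) ∩
        ((⋂ j, {p | a < p.1 j} ∩ {p | p.1 j ≤ b}) ∩ ⋂ j, {p | 0 < p.2 j}) := by
    ext p
    simp only [Set.mem_preimage, Set.mem_ofPred_eq, IsConfig, MarkedPoints.times,
      MarkedPoints.marks, MarkedPoints.count, MarkedPoints.layer, StrictMono, Set.mem_inter_iff, Set.mem_iInter]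
  rw [h]
  refine .inter (.iInter fun i => .iInter fun j => .iInter fun _ => ?_)
    (.inter (.iInter fun j => .inter ?_ ?_) (.iInter fun j => ?_))
  · exact measurableSet_lt (by fun_prop) (by fun_prop)
  · exact measurableSet_lt (by fun_prop) (by fun_prop)
  · exact measurableSet_le (by fun_prop) (by fun_prop)
  · exact measurableSet_lt (by fun_prop) (by fun_prop)

lemma measurableEmbedding_points : MeasurableEmbedding (points : Config a b → MarkedPoints) :=
  MeasurableEmbedding.subtype_coe (measurableSet_isConfig a b)

/-- The dominating measure `dx` on the configurations on `(a, b]`: a product of counting measure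
for the number of points and Lebesgue measure for times and marks. -/
def lebesgue (a b : ℝ) : Measure (Config a b) := MarkedPoints.lebesgue.comap points

instance : SFinite (lebesgue a b) := by
  unfold lebesgue
  rw [← sum_sfiniteSeq MarkedPoints.lebesgue]
  have h : (Measure.sum (sfiniteSeq MarkedPoints.lebesgue)).comap
      (points : Config a b → MarkedPoints) =
        Measure.sum fun n => (sfiniteSeq MarkedPoints.lebesgue n).comap points := by
    ext s hs
    rw [Measure.sum_apply _ hs, measurableEmbedding_points.comap_apply,
      Measure.sum_apply _ (measurableEmbedding_points.measurableSet_image.2 hs)]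
    simp only [measurableEmbedding_points.comap_apply]
  rw [h]
  have : ∀ n, IsFiniteMeasure
      ((sfiniteSeq MarkedPoints.lebesgue n).comap (points : Config a b → MarkedPoints)) :=
    fun n => ⟨by
      rw [measurableEmbedding_points.comap_apply]
      exact measure_lt_top _ _⟩
  infer_instance

/-- The configuration on `(a, c]` made of a configuration on `(a, b]` and one on `(b, c]`. -/
def concat (hab : a ≤ b) (hbc : b ≤ c) (x : Config a b) (x' : Config b c) : Config a c :=
  ⟨x.points.append x'.points, x.2.append hab hbc x'.2⟩

lemma measurable_concat (hab : a ≤ b) (hbc : b ≤ c) :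
    Measurable fun z : Config a b × Config b c => z.1.concat hab hbc z.2 :=
  Measurable.subtype_mk
    (MarkedPoints.measurable_append.comp (measurable_points.prodMap measurable_points))

end Config

/-! ### The model -/

/-- A Cox process model. The hidden marked point process `x` has points that arrive with rate `ν`,
and independent exponential marks of mean `γ`. Given `x`, observed events arrive with intensity
`λ_u(x)`, which only depends on the points of `x` up to time `u`, and independently of the times
they carry marks that are `t`-distributed with one degree of freedom (Cauchy), with location `μ`
and scale `σ`. -/
structure CoxModel where
  /-- The intensity `λ_u(x)`. -/
  intensity : MarkedPoints → ℝ → ℝ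
  /-- The rate of the hidden points. -/
  ν : ℝ
  /-- The mean of a hidden mark. -/
  γ : ℝ
  /-- The location of the observed marks. -/
  μ : ℝ
  /-- The scale of the observed marks. -/
  σ : ℝ≥0
  ν_pos : 0 < ν
  γ_pos : 0 < γ
  σ_pos : 0 < σ
  measurable_intensity : Measurable (Function.uncurry intensity)
  intensity_nonneg : ∀ (b : ℝ) (x : Config 0 b) (u : ℝ), 0 ≤ u → u ≤ b →
    0 ≤ intensity x.points u
  intervalIntegrable_intensity : ∀ (b : ℝ) (x : Config 0 b), 0 ≤ b →
    IntervalIntegrable (intensity x.points) volume 0 b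
  intensity_concat : ∀ (b c : ℝ) (hb : 0 ≤ b) (hbc : b ≤ c) (x : Config 0 b) (x' : Config b c)
    (u : ℝ), 0 ≤ u → u ≤ b →
      intensity (x.concat hb hbc x').points u = intensity x.points u

/-- The record of the observed marked point process on `[0, T]`: `r` events with times
`0 < ω_1 < ⋯ < ω_r < T` and marks `ξ_1, …, ξ_r`. -/
structure Observations where
  /-- The time horizon. -/
  T : ℝ
  /-- The number of observed events. -/
  r : ℕ
  /-- The times of the observed events. -/
  ω : Fin r → ℝ
  /-- The marks of the observed events. -/
  ξ : Fin r → ℝ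
  strictMono : StrictMono ω
  mem_Ioo : ∀ i, ω i ∈ Set.Ioo 0 T

/-- The times `0 = t_0 < t_1 < t_2 < ⋯` of the inference. -/
structure InferenceTimes where
  /-- The time `t_n`. -/
  time : ℕ → ℝ
  time_zero : time 0 = 0
  strictMono : StrictMono time

lemma InferenceTimes.nonneg (τ : InferenceTimes) (n : ℕ) : 0 ≤ τ.time n :=
  τ.time_zero ▸ τ.strictMono.monotone (Nat.zero_le n)

lemma InferenceTimes.le_succ (τ : InferenceTimes) (n : ℕ) : τ.time n ≤ τ.time (n + 1) :=
  τ.strictMono.monotone (Nat.le_succ n)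

/-- The shot-noise intensity
`λ_u(x) = λ_0 exp(-s u) + ∑_{j : φ_j ≤ u} ζ_j exp(-s (u - φ_j))`. -/
def shotNoiseIntensity (lam0 s : ℝ) (x : MarkedPoints) (u : ℝ) : ℝ :=
  lam0 * Real.exp (-s * u) +
    ∑ j : Fin x.count, if x.times j ≤ u then x.marks j * Real.exp (-s * (u - x.times j)) else 0

/-- The Cox process model whose intensity is the shot-noise process. -/
def CoxModel.shotNoise (lam0 s ν γ μ : ℝ) (σ : ℝ≥0) (hlam0 : 0 ≤ lam0) (hν : 0 < ν) (hγ : 0 < γ)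
    (hσ : 0 < σ) : CoxModel where
  intensity := shotNoiseIntensity lam0 s
  ν := ν
  γ := γ
  μ := μ
  σ := σ
  ν_pos := hν
  γ_pos := hγ
  σ_pos := hσ
  measurable_intensity := by
    intro A hA
    have h : ∀ k : ℕ, Measurable fun q : ((Fin k → ℝ) × (Fin k → ℝ)) × ℝ =>
        shotNoiseIntensity lam0 s (MarkedPoints.layer k q.1) q.2 := by
      intro k
      have hj : ∀ j : Fin k, Measurable fun q : ((Fin k → ℝ) × (Fin k → ℝ)) × ℝ =>
          if q.1.1 j ≤ q.2 then q.1.2 j * Real.exp (-s * (q.2 - q.1.1 j)) else 0 := fun j =>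
        Measurable.ite (measurableSet_le (by fun_prop) (by fun_prop)) (by fun_prop)
          measurable_const
      have hs : Measurable fun q : ((Fin k → ℝ) × (Fin k → ℝ)) × ℝ => ∑ j : Fin k,
          if q.1.1 j ≤ q.2 then q.1.2 j * Real.exp (-s * (q.2 - q.1.1 j)) else 0 :=
        Finset.measurable_fun_sum _ fun j _ => hj j
      have he : Measurable fun q : ((Fin k → ℝ) × (Fin k → ℝ)) × ℝ =>
          lam0 * Real.exp (-s * q.2) := by fun_prop
      exact he.add hs
    have h2 : Function.uncurry (shotNoiseIntensity lam0 s) ⁻¹' A =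
        ⋃ k : ℕ, Prod.map (MarkedPoints.layer k) id ''
            ((fun q => shotNoiseIntensity lam0 s (MarkedPoints.layer k q.1) q.2) ⁻¹' A) := by
      ext ⟨⟨k, p⟩, u⟩
      simp only [Set.mem_preimage, Set.mem_iUnion, Set.mem_image]
      constructor
      · intro h
        exact ⟨k, (p, u), h, rfl⟩
      · rintro ⟨l, q, h, hq⟩
        have h' : shotNoiseIntensity lam0 s (MarkedPoints.layer l q.1) q.2 =
            shotNoiseIntensity lam0 s ⟨k, p⟩ u :=
          congrArg (Function.uncurry (shotNoiseIntensity lam0 s)) hq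
        exact Set.mem_of_eq_of_mem h'.symm h
    rw [h2]
    exact .iUnion fun k => ((MarkedPoints.measurableEmbedding_layer k).prodMap
      MeasurableEmbedding.id).measurableSet_image.2 (h k hA)
  intensity_nonneg := by
    intro b x u _ _
    refine add_nonneg (mul_nonneg hlam0 (Real.exp_nonneg _)) (Finset.sum_nonneg fun j _ => ?_)
    split_ifs
    · exact mul_nonneg (x.2.2.2 j).le (Real.exp_nonneg _)
    · exact le_rfl
  intervalIntegrable_intensity := by
    intro b x hb
    unfold shotNoiseIntensity
    refine IntervalIntegrable.add (Continuous.intervalIntegrable (by fun_prop) _ _) ?_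
    rw [intervalIntegrable_iff]
    refine integrable_finsetSum _ fun j _ => ?_
    refine Integrable.indicator (s := {u | x.points.times j ≤ u})
      (f := fun u => x.points.marks j * Real.exp (-s * (u - x.points.times j))) ?_
      (measurableSet_le measurable_const measurable_id)
    exact (Continuous.intervalIntegrable (by fun_prop) 0 b).def'
  intensity_concat := by
    intro b c hb hbc x x' u _ hu
    obtain ⟨⟨k, φ, ζ⟩, hx⟩ := x
    obtain ⟨⟨l, φ', ζ'⟩, hx'⟩ := x'
    change lam0 * Real.exp (-s * u) + ∑ j : Fin (k + l),
        (if Fin.append φ φ' j ≤ u then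
          Fin.append ζ ζ' j * Real.exp (-s * (u - Fin.append φ φ' j)) else 0) =
      lam0 * Real.exp (-s * u) + ∑ j : Fin k,
        (if φ j ≤ u then ζ j * Real.exp (-s * (u - φ j)) else 0)
    rw [Fin.sum_univ_add]
    simp only [Fin.append_left, Fin.append_right, add_right_inj, add_eq_left]
    exact Finset.sum_eq_zero fun j _ => if_neg (not_le.2 (hu.trans_lt (hx'.2.1 j).1))

/-- The prior density `𝗉` of the hidden points on `(a, b]`: the number of points is Poisson of mean
`ν (b - a)`, given their number `k` the times are uniform on `Φ_{k,(a,b]}`, whose volume is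
`(b - a)^k / k!`, and the marks are independent and exponential. -/
def priorDensity (m : CoxModel) (a b : ℝ) (x : Config a b) : ℝ :=
  (Real.exp (-(m.ν * (b - a))) * (m.ν * (b - a)) ^ x.points.count / x.points.count.factorial) *
    ((b - a) ^ x.points.count / x.points.count.factorial)⁻¹ *
      ∏ j, exponentialPDFReal (1 / m.γ) (x.points.marks j)

/-- The prior law of the hidden points on `(a, b]`. -/
def prior (m : CoxModel) (a b : ℝ) : Measure (Config a b) :=
  (Config.lebesgue a b).withDensity fun x => ENNReal.ofReal (priorDensity m a b x)

instance (m : CoxModel) (a b : ℝ) : SFinite (prior m a b) := by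
  unfold prior
  infer_instance

/-- The likelihood `l_{(a,b]}(y; x)` of the events observed in `(a, b]`, given the hidden points `x`
on `(0, b]`: the product of `p(ξ_i; μ, σ) λ_{ω_i}(x)` over the events with `ω_i ∈ (a, b]`, times
`exp(-∫_a^b λ_u(x) du)`. -/
def likelihood (m : CoxModel) (y : Observations) (a b : ℝ) (x : Config 0 b) : ℝ :=
  (∏ i with a < y.ω i ∧ y.ω i ≤ b,
      cauchyPDFReal m.μ m.σ (y.ξ i) * m.intensity x.points (y.ω i)) *
    Real.exp (-∫ u in a..b, m.intensity x.points u)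

/-- The measure of density `l_{[0,b]}(y; x) 𝗉(x)`: the posterior up to normalisation. -/
def unnormalizedPosterior (m : CoxModel) (y : Observations) (b : ℝ) : Measure (Config 0 b) :=
  (Config.lebesgue 0 b).withDensity fun x =>
    ENNReal.ofReal (likelihood m y 0 b x * priorDensity m 0 b x)

/-- The normalising constant of the posterior at time `b`. -/
def evidence (m : CoxModel) (y : Observations) (b : ℝ) : ℝ≥0∞ :=
  unnormalizedPosterior m y b Set.univ

/-! ### The posteriors at the inference times -/

/-- The space `E_n` of the hidden configurations up to time `t_n`. -/
abbrev State (τ : InferenceTimes) (n : ℕ) : Type := Config 0 (τ.time n)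

/-- The space of the hidden configurations between the times `t_n` and `t_{n+1}`. -/
abbrev Increment (τ : InferenceTimes) (n : ℕ) : Type := Config (τ.time n) (τ.time (n + 1))

/-- The element `(x_n, x_{n+1,1})` of `E_{n+1}`. -/
def extend (τ : InferenceTimes) (n : ℕ) (z : State τ n × Increment τ n) : State τ (n + 1) :=
  z.1.concat (τ.nonneg n) (τ.le_succ n) z.2

/-- The posterior `π_n` of the hidden points up to time `t_n`. -/
def posterior (m : CoxModel) (y : Observations) (τ : InferenceTimes) (n : ℕ) :
    Measure (State τ n) :=
  (evidence m y (τ.time n))⁻¹ • unnormalizedPosterior m y (τ.time n)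

/-- `l_{(t_n,t_{n+1}]}(y_{n+1,1}; (x, x')) 𝗉(x')`. -/
def incrementWeight (m : CoxModel) (y : Observations) (τ : InferenceTimes) (n : ℕ)
    (z : State τ n × Increment τ n) : ℝ≥0∞ :=
  ENNReal.ofReal (likelihood m y (τ.time n) (τ.time (n + 1)) (extend τ n z) *
    priorDensity m (τ.time n) (τ.time (n + 1)) z.2)

/-- The predictive density `p_{n+1}(y_{n+1,1} | y_n)`. -/
def predictive (m : CoxModel) (y : Observations) (τ : InferenceTimes) (n : ℕ) : ℝ≥0∞ :=
  ∫⁻ x, ∫⁻ x', incrementWeight m y τ n (x, x') ∂(Config.lebesgue (τ.time n) (τ.time (n + 1)))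
    ∂(posterior m y τ n)

/-- The weight `g_{n+1}(x, x') = l_{(t_n,t_{n+1}]}(y_{n+1,1}; (x, x')) 𝗉(x') /
p_{n+1}(y_{n+1,1} | y_n)`. -/
def filteringWeight (m : CoxModel) (y : Observations) (τ : InferenceTimes) (n : ℕ)
    (z : State τ n × Increment τ n) : ℝ≥0∞ :=
  incrementWeight m y τ n z / predictive m y τ n

/-! ### The algorithm -/

/-- The empirical measure of the points `χ_1, …, χ_N`. -/
def empirical {α : Type*} [MeasurableSpace α] {N : ℕ} (χ : Fin N → α) : Measure α :=
  (N : ℝ≥0∞)⁻¹ • ∑ i, Measure.dirac (χ i)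

/-- The empirical measure, as a kernel. -/
def empiricalKernel (α : Type*) [MeasurableSpace α] (N : ℕ) : Kernel (Fin N → α) α where
  toFun χ := empirical χ
  measurable' := by
    refine Measure.measurable_of_measurable_coe _ fun s hs => ?_
    simp only [empirical, Measure.smul_apply, Measure.finsetSum_apply, smul_eq_mul,
      Measure.dirac_apply' _ hs]
    refine Measurable.const_mul (Finset.measurable_fun_sum _ fun i _ => ?_) _
    exact (measurable_one.indicator hs).comp (measurable_pi_apply i)

instance (α : Type*) [MeasurableSpace α] (N : ℕ) : IsFiniteKernel (empiricalKernel α N) := by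
  refine ⟨1, ENNReal.one_lt_top, fun χ => ?_⟩
  change empirical χ Set.univ ≤ 1
  simp only [empirical, Measure.smul_apply, Measure.finsetSum_apply, measure_univ,
    Finset.sum_const, Finset.card_univ, Fintype.card_fin, smul_eq_mul, nsmul_eq_mul, mul_one]
  exact ENNReal.inv_mul_le_one _

/-- The measure `l_{(t_n,t_{n+1}]} 𝗉(x') dx' S(dx)` on `E_{n+1}`, where `S` is the empirical measure
of `χ_1, …, χ_N ∈ E_n`. -/
def unnormalizedTarget (m : CoxModel) (y : Observations) (τ : InferenceTimes) (n : ℕ) {N : ℕ}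
    (χ : Fin N → State τ n) : Measure (State τ (n + 1)) :=
  (((empirical χ).prod (Config.lebesgue (τ.time n) (τ.time (n + 1)))).withDensity
    (incrementWeight m y τ n)).map (extend τ n)

/-- The approximation `π_{n+1}^N` of `π_{n+1}`, in which the empirical measure of
`χ_1, …, χ_N ∈ E_n` takes the place of `π_n`. -/
def approxPosterior (m : CoxModel) (y : Observations) (τ : InferenceTimes) (n : ℕ) {N : ℕ}
    (χ : Fin N → State τ n) : Measure (State τ (n + 1)) :=
  (unnormalizedTarget m y τ n χ Set.univ)⁻¹ • unnormalizedTarget m y τ n χ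

/-- The transition kernels of the algorithm: `K_1` on `E_1`, and, for `n ≥ 1`, the kernel on
`E_{n+1}` that is used at step `n + 1` and depends on the `N` samples of step `n`. -/
structure TransitionKernels (τ : InferenceTimes) where
  /-- The kernel of the first step. -/
  first : Kernel (State τ 1) (State τ 1)
  /-- The kernel of step `n + 1`, which takes the samples of step `n` and the current state. -/
  step : ∀ n N : ℕ, Kernel ((Fin N → State τ n) × State τ (n + 1)) (State τ (n + 1))
  isMarkovKernel_first : IsMarkovKernel first
  isMarkovKernel_step : ∀ n N : ℕ, IsMarkovKernel (step n N)

/-- The kernels are MCMC kernels for the steps `1, …, M`: `K_1` has invariant distribution `π_1`,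
and the kernel of step `n + 1` has invariant distribution `π_{n+1}^N`. -/
structure TransitionKernels.IsMCMC {τ : InferenceTimes} (K : TransitionKernels τ) (m : CoxModel)
    (y : Observations) (M : ℕ) : Prop where
  first : 1 ≤ M → K.first.Invariant (posterior m y τ 1)
  step : ∀ n, 1 ≤ n → n + 1 ≤ M → ∀ N, 1 ≤ N → ∀ χ : Fin N → State τ n,
    ((K.step n N).sectR χ).Invariant (approxPosterior m y τ n χ)

/-- Assumption (A) for the steps `1, …, M`. -/
structure AssumptionA {τ : InferenceTimes} (K : TransitionKernels τ) (m : CoxModel)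
    (y : Observations) (M : ℕ) : Prop where
  minorization_first : 1 ≤ M → ∃ ε : ℝ, 0 < ε ∧ ε < 1 ∧ ∃ κ : Measure (State τ 1),
    IsProbabilityMeasure κ ∧ ∀ x, ENNReal.ofReal ε • κ ≤ K.first x
  minorization_step : ∀ n, 1 ≤ n → n + 1 ≤ M → ∃ ε : ℝ, 0 < ε ∧ ε < 1 ∧
    ∃ κ : Measure (Increment τ n), IsProbabilityMeasure κ ∧
      ∀ N, 1 ≤ N → ∀ (χ : Fin N → State τ n) (x : State τ (n + 1)),
        ENNReal.ofReal ε • ((empirical χ).prod κ).map (extend τ n) ≤ K.step n N (χ, x)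
  weight : ∀ n, 1 ≤ n → n + 1 ≤ M →
    ⨆ x : State τ n, ∫⁻ x', filteringWeight m y τ n (x, x')
      ∂(Config.lebesgue (τ.time n) (τ.time (n + 1))) < ∞

/-- The law of the first `N` states `X^{(1)}, …, X^{(N)}` of the Markov chain with transition kernel
`K (c, ·)` and `X^{(1)} = x`, as a kernel in `(c, x)`: after `X^{(1)}`, the rest is the chain that
starts from a draw of `K (c, x)`. -/
def chain {C E : Type*} [MeasurableSpace C] [MeasurableSpace E] (K : Kernel (C × E) E) :
    ∀ N : ℕ, Kernel (C × E) (Fin N → E)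
  | 0 => Kernel.const _ (Measure.dirac Fin.elim0)
  | N + 1 =>
    ((Kernel.deterministic Prod.snd measurable_snd) ×ₖ
      ((chain K N) ∘ₖ ((Kernel.deterministic Prod.fst measurable_fst) ×ₖ K))).map
        fun z : E × (Fin N → E) => (Fin.cons z.1 z.2 : Fin (N + 1) → E)

/-- The law of the first state of step `n + 1`, given the samples of step `n`: a draw from their
empirical measure, extended by a draw from the prior on `(t_n, t_{n+1}]`. -/
def initialDraw (m : CoxModel) (τ : InferenceTimes) (n N : ℕ) :
    Kernel (Fin N → State τ n) (State τ (n + 1)) :=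
  ((empiricalKernel (State τ n) N) ×ₖ
    (Kernel.const _ (prior m (τ.time n) (τ.time (n + 1))))).map (extend τ n)

/-- The law of the `N` samples of step `n + 1`, given the samples of step `n`. -/
def samplesGiven {τ : InferenceTimes} (K : TransitionKernels τ) (m : CoxModel) (n N : ℕ) :
    Kernel (Fin N → State τ n) (Fin N → State τ (n + 1)) :=
  (chain (K.step n N) N) ∘ₖ (Kernel.id ×ₖ (initialDraw m τ n N))

/-- The law of the `N` samples `(X_n^{(1)}, …, X_n^{(N)})` of step `n ≥ 1`, when the algorithm starts
from `x₁ ∈ E_1`. (There is no step `0`.) -/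
def samplesLaw {τ : InferenceTimes} (K : TransitionKernels τ) (m : CoxModel) (N : ℕ)
    (x₁ : State τ 1) : ∀ n : ℕ, Measure (Fin N → State τ n)
  | 0 => 0
  | 1 => chain (K.first.comap Prod.snd measurable_snd : Kernel (Unit × State τ 1) (State τ 1)) N
      ((), x₁)
  | n + 2 => (samplesLaw K m N x₁ (n + 1)).bind (samplesGiven K m (n + 1) N)

end PPFilter

end

/-!
The proof is an induction on the step `n`, for the `p`-th moments of the errors
`S_n f - π_n f`, where `S_n` is the empirical measure of the samples of step `n`.

*One Markov chain.* Let `P` have invariant law `π` and satisfy `ε κ ≤ P (x, ·)`, and let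
`g = f - π f` with `|f| ≤ b`. Then `P` contracts oscillations by the factor `1 - ε`, so the expected
sums `h_N (x) = E_x [g (X_1) + ⋯ + g (X_N)]` have oscillation at most `D = 2 b / ε` for every `N`
(`expectedSum_mem_Icc`), and, as `π h_N = 0`, they are bounded by `D`. Since
`h_{N+1} = g + P h_N`, Hoeffding's lemma at each transition gives
`E_x exp (θ ∑ g (X_i)) ≤ exp (θ h_N (x) + N θ² D² / 8)` (`lintegral_exp_chain_le`). With
`θ = ± 1 / (D √N)` the right-hand side is bounded, and `t ^ p ≤ p ^ p exp t` turns this into a bound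
`C (b / √N) ^ p` for the `p`-th moment, in which `C` depends only on `p` and `ε`
(`lintegral_chain_average_le`). At step `n + 1` it applies conditionally on the samples `χ` of
step `n`, with a constant that does not depend on `χ`.

*One step of the filter.* A configuration up to `t_{n+1}` is one up to `t_n` followed by one on
`(t_n, t_{n+1}]`, and the Lebesgue measure, the prior and the likelihood factorise accordingly
(`Config.map_concat_lebesgue`, `priorDensity_concat`, `likelihood_concat`). Hence
`π_{n+1} f = π_n H_f` with `H_f (x) = ∫ g_{n+1} (x, x') f (x, x') dx'`
(`integral_posterior_succ`), while `π_{n+1}^N f = S_n H_f / S_n H_1`. As `|H_f| ≤ b H_1` and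
`π_n H_1 = 1`,
`|S_{n+1} f - π_{n+1} f| ≤ |S_{n+1} f - π_{n+1}^N f| + 2 b |S_n H_1 - π_n H_1| + |S_n H_f - π_n H_f|`.
The first term is the error of a Markov chain, and the induction hypothesis bounds the other two,
because `H_1` is bounded. If `S_n H_1 = 0`, then `π_{n+1}^N` is not a probability measure, but the
trivial bound `2 b = 2 b |S_n H_1 - 1|` is then of the same form
(`lintegral_samplesGiven_error_le`).
-/

namespace PPFilter

/-! ### Moment bounds for uniformly ergodic Markov chains -/

section Chain

variable {C E : Type*} [MeasurableSpace C] [MeasurableSpace E]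

lemma measurable_cons (N : ℕ) :
    Measurable fun z : E × (Fin N → E) => (Fin.cons z.1 z.2 : Fin (N + 1) → E) :=
  measurable_pi_iff.2 fun i => by
    induction i using Fin.cases with
    | zero => simpa using measurable_fst
    | succ i => simp only [Fin.cons_succ]; fun_prop

instance isMarkovKernel_chain (K : Kernel (C × E) E) [IsMarkovKernel K] (N : ℕ) :
    IsMarkovKernel (chain K N) := by
  induction N with
  | zero => unfold chain; infer_instance
  | succ N ih =>
    unfold chain
    exact Kernel.IsMarkovKernel.map _ (measurable_cons N)

/-- The Markov property at the first transition. -/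
lemma lintegral_chain_succ (K : Kernel (C × E) E) [IsMarkovKernel K] (N : ℕ) (c : C) (x : E)
    {φ : (Fin (N + 1) → E) → ℝ≥0∞} (hφ : Measurable φ) :
    ∫⁻ X, φ X ∂(chain K (N + 1) (c, x)) =
      ∫⁻ x', ∫⁻ X, φ (Fin.cons x X : Fin (N + 1) → E) ∂(chain K N (c, x')) ∂(K (c, x)) := by
  have h1 : Measurable fun z : E × (Fin N → E) => φ (Fin.cons z.1 z.2 : Fin (N + 1) → E) :=
    hφ.comp (measurable_cons N)
  have h2 : Measurable fun X : Fin N → E => φ (Fin.cons x X : Fin (N + 1) → E) :=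
    h1.comp measurable_prodMk_left
  rw [chain, Kernel.lintegral_map _ (measurable_cons N) _ hφ,
    Kernel.lintegral_deterministic_prod _ _ _ h1, Kernel.lintegral_comp _ _ _ h2,
    Kernel.lintegral_deterministic_prod _ _ _ h2.lintegral_kernel]

/-- The expectation of `g (X_1) + ⋯ + g (X_N)` for the chain with transition kernel `P`, as a
function of the initial state. -/
noncomputable def expectedSum (P : Kernel E E) (g : E → ℝ) : ℕ → E → ℝ
  | 0 => fun _ => 0
  | N + 1 => fun x => g x + ∫ z, expectedSum P g N z ∂(P x)

variable {P : Kernel E E}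

lemma measurable_expectedSum {g : E → ℝ} (hg : Measurable g) (N : ℕ) :
    Measurable (expectedSum P g N) := by
  induction N with
  | zero => exact measurable_const
  | succ N ih => exact hg.add (ih.stronglyMeasurable.integral_kernel).measurable

lemma integrable_of_mem_Icc {μ : Measure E} [IsFiniteMeasure μ] {h : E → ℝ} (hm : Measurable h)
    {a b : ℝ} (hab : ∀ x, h x ∈ Set.Icc a b) : Integrable h μ :=
  .of_mem_Icc a b hm.aemeasurable (.of_forall hab)

/-- Under a minorization `ε κ ≤ P (x, ·)` the oscillation of `x ↦ P h (x)` is at most `1 - ε` times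
that of `h`. -/
lemma integral_mem_Icc_of_minorization [IsMarkovKernel P] {ε : ℝ} (hε : 0 < ε) {κ : Measure E}
    [IsProbabilityMeasure κ] (hmin : ∀ x, ENNReal.ofReal ε • κ ≤ P x) {h : E → ℝ}
    (hm : Measurable h) {a D : ℝ} (hh : ∀ x, h x ∈ Set.Icc a (a + D)) (x : E) :
    ∫ z, h z ∂(P x) ∈
      Set.Icc ((1 - ε) * a + ε * ∫ z, h z ∂κ) ((1 - ε) * a + ε * ∫ z, h z ∂κ + (1 - ε) * D) := by
  have key : ∀ u : E → ℝ, Measurable u → (∀ z, 0 ≤ u z) → (∃ b, ∀ z, u z ≤ b) →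
      ε * ∫ z, u z ∂κ ≤ ∫ z, u z ∂(P x) := by
    rintro u hu h0 ⟨b, hb⟩
    have hi : Integrable u (P x) := integrable_of_mem_Icc hu fun z => ⟨h0 z, hb z⟩
    have := integral_mono_measure (hmin x) (.of_forall h0) hi
    rwa [integral_smul_measure, ENNReal.toReal_ofReal hε.le, smul_eq_mul] at this
  have hiP : Integrable h (P x) := integrable_of_mem_Icc hm hh
  have hik : Integrable h κ := integrable_of_mem_Icc hm hh
  have h1 := key (fun z => h z - a) (hm.sub_const a) (fun z => sub_nonneg.2 (hh z).1)
    ⟨D, fun z => by linarith [(hh z).2]⟩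
  have h2 := key (fun z => a + D - h z) (hm.const_sub _) (fun z => sub_nonneg.2 (hh z).2)
    ⟨D, fun z => by linarith [(hh z).1]⟩
  rw [integral_sub hiP (integrable_const _), integral_sub hik (integrable_const _)] at h1
  rw [integral_sub (integrable_const _) hiP, integral_sub (integrable_const _) hik] at h2
  simp only [integral_const, probReal_univ, smul_eq_mul, one_mul] at h1 h2
  constructor <;> linarith

/-- The oscillation of the expected sums is bounded uniformly in the number of terms. -/
lemma expectedSum_mem_Icc [IsMarkovKernel P] {ε : ℝ} (hε : 0 < ε) {κ : Measure E}
    [IsProbabilityMeasure κ] (hmin : ∀ x, ENNReal.ofReal ε • κ ≤ P x) {g : E → ℝ}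
    (hg : Measurable g) {a₀ D : ℝ} (hD : 0 ≤ D) (hg' : ∀ x, g x ∈ Set.Icc a₀ (a₀ + ε * D)) (N : ℕ) :
    ∃ a, ∀ x, expectedSum P g N x ∈ Set.Icc a (a + D) := by
  induction N with
  | zero => exact ⟨0, fun x => by simpa [expectedSum] using hD⟩
  | succ N ih =>
    obtain ⟨a, ha⟩ := ih
    refine ⟨a₀ + ((1 - ε) * a + ε * ∫ z, expectedSum P g N z ∂κ), fun x => ?_⟩
    have h := integral_mem_Icc_of_minorization hε hmin (measurable_expectedSum hg N) ha x
    have h' := hg' x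
    simp only [Set.mem_Icc, expectedSum] at h h' ⊢
    constructor <;> linarith [h.1, h.2, h'.1, h'.2]

lemma integral_integral_of_invariant {π : Measure E} (hinv : P.Invariant π)
    {h : E → ℝ} (hi : Integrable h π) : ∫ x, ∫ z, h z ∂(P x) ∂π = ∫ z, h z ∂π := by
  have h1 : (P ∘ₖ Kernel.const Unit π) () = π := by
    rw [Kernel.comp_apply, Kernel.const_apply, hinv.def]
  have h2 := Kernel.integral_comp (η := P) (κ := Kernel.const Unit π) (a := ()) (f := h)
    (by rwa [h1])
  rw [h1, Kernel.const_apply] at h2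
  exact h2.symm

/-- Under the invariant law, the expected sums of a centred function have mean zero. -/
lemma integral_expectedSum [IsMarkovKernel P] {ε : ℝ} (hε : 0 < ε) {κ : Measure E}
    [IsProbabilityMeasure κ] (hmin : ∀ x, ENNReal.ofReal ε • κ ≤ P x) {π : Measure E}
    [IsProbabilityMeasure π] (hinv : P.Invariant π) {g : E → ℝ}
    (hg : Measurable g) {a₀ D : ℝ} (hD : 0 ≤ D) (hg' : ∀ x, g x ∈ Set.Icc a₀ (a₀ + ε * D))
    (hg0 : ∫ x, g x ∂π = 0) (N : ℕ) : ∫ x, expectedSum P g N x ∂π = 0 := by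
  induction N with
  | zero => simp [expectedSum]
  | succ N ih =>
    obtain ⟨a, ha⟩ := expectedSum_mem_Icc hε hmin hg hD hg' N
    have hm := measurable_expectedSum (P := P) hg N
    have hi : Integrable (fun x => ∫ z, expectedSum P g N z ∂(P x)) π :=
      integrable_of_mem_Icc hm.stronglyMeasurable.integral_kernel.measurable
        (integral_mem_Icc_of_minorization hε hmin hm ha)
    simp only [expectedSum]
    rw [integral_add (integrable_of_mem_Icc hg hg') hi, hg0,
      integral_integral_of_invariant hinv (integrable_of_mem_Icc hm ha), ih, add_zero]

/-- Hoeffding's lemma for a function whose oscillation is at most `D`. -/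
lemma lintegral_exp_le {μ : Measure E} [IsProbabilityMeasure μ] {h : E → ℝ} (hm : Measurable h)
    {a D : ℝ} (hD : 0 ≤ D) (hh : ∀ x, h x ∈ Set.Icc a (a + D)) (θ : ℝ) :
    ∫⁻ x, ENNReal.ofReal (Real.exp (θ * h x)) ∂μ ≤
      ENNReal.ofReal (Real.exp (θ * ∫ x, h x ∂μ + θ ^ 2 * D ^ 2 / 8)) := by
  have hs := hasSubgaussianMGF_of_mem_Icc (μ := μ) hm.aemeasurable (.of_forall hh)
  have h1 := hs.mgf_le θ
  have hint : Integrable (fun x => Real.exp (θ * h x)) μ := by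
    have := (hs.integrable_exp_mul θ).const_mul (Real.exp (θ * ∫ x, h x ∂μ))
    refine this.congr (.of_forall fun x => ?_)
    simp only [← Real.exp_add]
    ring_nf
  rw [← ofReal_integral_eq_lintegral_ofReal hint (.of_forall fun x => Real.exp_nonneg _)]
  refine ENNReal.ofReal_le_ofReal ?_
  have h2 : ∫ x, Real.exp (θ * h x) ∂μ =
      Real.exp (θ * ∫ x, h x ∂μ) * mgf (fun x => h x - ∫ x, h x ∂μ) μ θ := by
    rw [mgf, ← integral_const_mul]
    refine integral_congr_ae (.of_forall fun x => ?_)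
    simp only [← Real.exp_add]
    ring_nf
  rw [h2, Real.exp_add]
  refine mul_le_mul_of_nonneg_left (h1.trans (le_of_eq ?_)) (Real.exp_nonneg _)
  congr 1
  simp [abs_of_nonneg hD]
  ring

/-- The exponential moments of the sum along the chain: each transition adds, by Hoeffding's lemma
applied to the expected sum of the remaining terms, a factor that does not depend on the state. -/
lemma lintegral_exp_chain_le {K : Kernel (C × E) E} [IsMarkovKernel K] (c : C)
    {ε : ℝ} (hε : 0 < ε) {κ : Measure E}
    [IsProbabilityMeasure κ] (hmin : ∀ x, ENNReal.ofReal ε • κ ≤ K (c, x)) {g : E → ℝ}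
    (hg : Measurable g) {a₀ D : ℝ} (hD : 0 ≤ D) (hg' : ∀ x, g x ∈ Set.Icc a₀ (a₀ + ε * D))
    (θ : ℝ) (N : ℕ) (x : E) :
    ∫⁻ X, ENNReal.ofReal (Real.exp (θ * ∑ i, g (X i))) ∂(chain K N (c, x)) ≤
      ENNReal.ofReal (Real.exp (θ * expectedSum (K.sectR c) g N x + N * (θ ^ 2 * D ^ 2 / 8))) := by
  have hmin' : ∀ x, ENNReal.ofReal ε • κ ≤ K.sectR c x := hmin
  induction N generalizing x with
  | zero => simp [chain, expectedSum]
  | succ N ih =>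
    obtain ⟨a, ha⟩ := expectedSum_mem_Icc (P := K.sectR c) hε hmin' hg hD hg' N
    have hm : Measurable fun X : Fin N → E => ENNReal.ofReal (Real.exp (θ * ∑ i, g (X i))) := by
      fun_prop
    rw [lintegral_chain_succ _ _ _ _ (by fun_prop)]
    simp only [Fin.sum_univ_succ, Fin.cons_zero, Fin.cons_succ, mul_add, Real.exp_add,
      ENNReal.ofReal_mul (Real.exp_nonneg _)]
    calc ∫⁻ x', ∫⁻ X, ENNReal.ofReal (Real.exp (θ * g x)) *
            ENNReal.ofReal (Real.exp (θ * ∑ i, g (X i))) ∂(chain K N (c, x')) ∂(K (c, x))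
        = ∫⁻ x', ENNReal.ofReal (Real.exp (θ * g x)) *
            ∫⁻ X, ENNReal.ofReal (Real.exp (θ * ∑ i, g (X i))) ∂(chain K N (c, x'))
              ∂(K (c, x)) := by
          simp only [lintegral_const_mul _ hm]
      _ ≤ ∫⁻ x', ENNReal.ofReal (Real.exp (θ * g x)) *
            (ENNReal.ofReal (Real.exp (N * (θ ^ 2 * D ^ 2 / 8))) *
              ENNReal.ofReal (Real.exp (θ * expectedSum (K.sectR c) g N x'))) ∂(K (c, x)) := by
          refine lintegral_mono fun x' => mul_le_mul_right (α := ℝ≥0∞) ((ih x').trans_eq ?_) _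
          rw [Real.exp_add, ENNReal.ofReal_mul (Real.exp_nonneg _), mul_comm]
      _ = ENNReal.ofReal (Real.exp (θ * g x)) *
            (ENNReal.ofReal (Real.exp (N * (θ ^ 2 * D ^ 2 / 8))) *
              ∫⁻ x', ENNReal.ofReal (Real.exp (θ * expectedSum (K.sectR c) g N x'))
                ∂(K (c, x))) := by
          have hme := measurable_expectedSum (P := K.sectR c) hg N
          rw [lintegral_const_mul _ (by fun_prop), lintegral_const_mul _ (by fun_prop)]
      _ ≤ ENNReal.ofReal (Real.exp (θ * g x)) *
            (ENNReal.ofReal (Real.exp (N * (θ ^ 2 * D ^ 2 / 8))) *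
              ENNReal.ofReal (Real.exp (θ * ∫ x', expectedSum (K.sectR c) g N x' ∂(K (c, x)) +
                θ ^ 2 * D ^ 2 / 8))) := by
          gcongr
          exact lintegral_exp_le (measurable_expectedSum hg N) hD ha θ
      _ = _ := by
          simp only [← ENNReal.ofReal_mul (Real.exp_nonneg _), ← Real.exp_add, expectedSum,
            Kernel.sectR_apply]
          push_cast
          ring_nf

lemma rpow_le_rpow_mul_exp {p t : ℝ} (hp : 0 < p) (ht : 0 ≤ t) :
    t ^ p ≤ p ^ p * Real.exp t := by
  have h : t ≤ p * Real.exp (t / p) := by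
    have := Real.add_one_le_exp (t / p)
    calc t = p * (t / p) := by field_simp
      _ ≤ p * Real.exp (t / p) := by gcongr; linarith
  calc t ^ p ≤ (p * Real.exp (t / p)) ^ p := Real.rpow_le_rpow ht h hp.le
    _ = p ^ p * Real.exp t := by
      rw [Real.mul_rpow hp.le (Real.exp_nonneg _), ← Real.exp_mul, div_mul_cancel₀ _ hp.ne']

/-- The `L^p` error of the time averages of a chain that satisfies a minorization condition, with a
constant that depends on the chain only through the minorization constant. -/
theorem lintegral_chain_average_le {K : Kernel (C × E) E} [IsMarkovKernel K] (c : C)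
    {ε : ℝ} (hε : 0 < ε) {κ : Measure E}
    [IsProbabilityMeasure κ] (hmin : ∀ x, ENNReal.ofReal ε • κ ≤ K (c, x)) {π : Measure E}
    [IsProbabilityMeasure π] (hinv : (K.sectR c).Invariant π) {p : ℝ} (hp : 0 < p)
    {f : E → ℝ} (hf : Measurable f) {b : ℝ} (hb : 0 < b) (hfb : ∀ x, |f x| ≤ b)
    {N : ℕ} (hN : 1 ≤ N) (x : E) :
    ∫⁻ X, ENNReal.ofReal (|(1 / (N : ℝ)) * ∑ i, f (X i) - ∫ x, f x ∂π| ^ p) ∂(chain K N (c, x)) ≤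
      ENNReal.ofReal (2 * Real.exp 2 * p ^ p * (2 / ε) ^ p * (b / √N) ^ p) := by
  have hN0 : (0 : ℝ) < N := by exact_mod_cast hN
  have hsq : (0 : ℝ) < √N := Real.sqrt_pos.2 hN0
  have hsq1 : 1 ≤ √(N : ℝ) := Real.one_le_sqrt.2 (by exact_mod_cast hN)
  have hsq2 : √(N : ℝ) ^ 2 = N := Real.sq_sqrt hN0.le
  set D : ℝ := 2 * b / ε with hDdef
  have hD : 0 < D := by positivity
  set m : ℝ := ∫ x, f x ∂π with hm
  set g : E → ℝ := fun x => f x - m with hgdef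
  have hg : Measurable g := hf.sub_const m
  have hfI : ∀ x, f x ∈ Set.Icc (-b) b := fun x => abs_le.1 (hfb x)
  have hεD : ε * D = 2 * b := by rw [hDdef]; field_simp
  have hg' : ∀ x, g x ∈ Set.Icc (-b - m) (-b - m + ε * D) := fun x => by
    rw [hεD]
    constructor <;> simp only [hgdef] <;> linarith [(hfI x).1, (hfI x).2]
  have hg0 : ∫ x, g x ∂π = 0 := by
    simp [hgdef, integral_sub (integrable_of_mem_Icc hf hfI) (integrable_const _), ← hm]
  have hmin' : ∀ x, ENNReal.ofReal ε • κ ≤ K.sectR c x := hmin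
  -- The expected sum has mean zero and oscillation at most `D`, so it is at most `D`.
  have hpot : |expectedSum (K.sectR c) g N x| ≤ D := by
    obtain ⟨a, ha⟩ := expectedSum_mem_Icc (P := K.sectR c) hε hmin' hg hD.le hg' N
    have h0 := integral_expectedSum hε hmin' hinv hg hD.le hg' hg0 N
    have hi := integrable_of_mem_Icc (μ := π) (measurable_expectedSum (P := K.sectR c) hg N) ha
    have h1 : a ≤ 0 := by
      have := integral_mono (integrable_const a) hi fun x => (ha x).1
      simpa [h0] using this
    have h2 : 0 ≤ a + D := by
      have := integral_mono hi (integrable_const (a + D)) fun x => (ha x).2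
      simpa [h0] using this
    rw [abs_le]
    constructor <;> linarith [(ha x).1, (ha x).2]
  have hexp : ∀ θ : ℝ, |θ| = 1 / (D * √N) →
      ∫⁻ X, ENNReal.ofReal (Real.exp (θ * ∑ i, g (X i))) ∂(chain K N (c, x)) ≤
        ENNReal.ofReal (Real.exp 2) := by
    intro θ hθ
    refine (lintegral_exp_chain_le c hε hmin hg hD.le hg' θ N x).trans
      (ENNReal.ofReal_le_ofReal (Real.exp_le_exp.2 ?_))
    have h1 : θ * expectedSum (K.sectR c) g N x ≤ 1 := by
      calc θ * expectedSum (K.sectR c) g N x ≤ |θ| * |expectedSum (K.sectR c) g N x| := by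
            rw [← abs_mul]; exact le_abs_self _
        _ ≤ 1 / (D * √N) * D := by rw [hθ]; gcongr
        _ = 1 / √N := by field_simp
        _ ≤ 1 := by rw [div_le_one hsq]; exact hsq1
    have h2 : N * (θ ^ 2 * D ^ 2 / 8) = 1 / 8 := by
      rw [← sq_abs θ, hθ, div_pow, mul_pow, hsq2]
      field_simp
    linarith
  set s : ℝ := 1 / (D * √N) with hs
  have hs0 : 0 < s := by positivity
  have hpt : ∀ X : Fin N → E, ENNReal.ofReal (|(1 / (N : ℝ)) * ∑ i, f (X i) - m| ^ p) ≤
      ENNReal.ofReal ((D / √N) ^ p * p ^ p) *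
        (ENNReal.ofReal (Real.exp (s * ∑ i, g (X i))) +
          ENNReal.ofReal (Real.exp (-s * ∑ i, g (X i)))) := by
    intro X
    rw [← ENNReal.ofReal_add (Real.exp_nonneg _) (Real.exp_nonneg _),
      ← ENNReal.ofReal_mul (by positivity)]
    refine ENNReal.ofReal_le_ofReal ?_
    have h1 : (1 / (N : ℝ)) * ∑ i, f (X i) - m = (D / √N) * (s * ∑ i, g (X i)) := by
      simp only [hgdef, Finset.sum_sub_distrib, Finset.sum_const, Finset.card_univ,
        Fintype.card_fin, nsmul_eq_mul, hs]
      have h3 : D / √N * (1 / (D * √N)) = 1 / N := by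
        rw [div_mul_div_comm, mul_one, mul_left_comm, ← sq, hsq2]
        field_simp
      rw [← mul_assoc, h3]
      field_simp
    rw [h1, abs_mul, abs_of_pos (by positivity : 0 < D / √N), mul_assoc,
      Real.mul_rpow (by positivity) (abs_nonneg _)]
    refine mul_le_mul_of_nonneg_left ?_ (by positivity)
    refine (rpow_le_rpow_mul_exp hp (abs_nonneg _)).trans ?_
    refine mul_le_mul_of_nonneg_left ?_ (by positivity)
    rw [neg_mul]
    exact Real.exp_abs_le _
  refine (lintegral_mono hpt).trans ?_
  rw [lintegral_const_mul _ (by fun_prop), lintegral_add_left (by fun_prop)]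
  calc _ ≤ ENNReal.ofReal ((D / √N) ^ p * p ^ p) *
        (ENNReal.ofReal (Real.exp 2) + ENNReal.ofReal (Real.exp 2)) := by
        gcongr
        · exact hexp s (abs_of_pos hs0)
        · exact hexp (-s) (by rw [abs_neg, abs_of_pos hs0])
    _ = _ := by
        rw [← ENNReal.ofReal_add (Real.exp_nonneg _) (Real.exp_nonneg _),
          ← ENNReal.ofReal_mul (by positivity)]
        congr 1
        have h4 : D / √N = (2 / ε) * (b / √N) := by rw [hDdef]; field_simp
        rw [h4, Real.mul_rpow (by positivity) (by positivity)]
        ring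

end Chain

/-! ### The Lebesgue measure on configurations is a product over consecutive intervals -/

namespace MarkedPoints

lemma volume_preserving_fin_append (k l : ℕ) :
    MeasurePreserving (fun p : (Fin k → ℝ) × (Fin l → ℝ) => Fin.append p.1 p.2) where
  measurable := measurable_pi_lambda _ fun j => by
    induction j using Fin.addCases with
    | left j => simp only [Fin.append_left]; fun_prop
    | right j => simp only [Fin.append_right]; fun_prop
  map_eq := by
    refine (Measure.pi_eq fun s hs => ?_).symm
    have hpre : (fun p : (Fin k → ℝ) × (Fin l → ℝ) => Fin.append p.1 p.2) ⁻¹' Set.univ.pi s =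
        (Set.univ.pi fun i => s (Fin.castAdd l i)) ×ˢ
          (Set.univ.pi fun i => s (Fin.natAdd k i)) := by
      ext p
      simp only [Set.mem_preimage, Set.mem_univ_pi, Set.mem_prod]
      constructor
      · intro h
        exact ⟨fun i => by simpa using h (Fin.castAdd l i), fun i => by simpa using h (Fin.natAdd k i)⟩
      · rintro ⟨h₁, h₂⟩ j
        induction j using Fin.addCases with
        | left j => simpa using h₁ j
        | right j => simpa using h₂ j
    rw [Measure.map_apply _ (.univ_pi hs), hpre, Measure.volume_eq_prod, Measure.prod_prod,
      volume_pi_pi, volume_pi_pi, Fin.prod_univ_add]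
    refine measurable_pi_lambda _ fun j => ?_
    induction j using Fin.addCases with
    | left j => simp only [Fin.append_left]; fun_prop
    | right j => simp only [Fin.append_right]; fun_prop

lemma map_prodProdProdComm {α β γ δ : Type*} [MeasurableSpace α] [MeasurableSpace β]
    [MeasurableSpace γ] [MeasurableSpace δ] (μ₁ : Measure α) (μ₂ : Measure β) (μ₃ : Measure γ)
    (μ₄ : Measure δ) [SFinite μ₁] [SFinite μ₂] [SFinite μ₃] [SFinite μ₄] :
    ((μ₁.prod μ₂).prod (μ₃.prod μ₄)).map (fun q => ((q.1.1, q.2.1), (q.1.2, q.2.2))) =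
      (μ₁.prod μ₃).prod (μ₂.prod μ₄) := by
  refine Measure.ext_of_lintegral _ fun f hf => ?_
  rw [lintegral_map hf (by fun_prop), lintegral_prod _ (by fun_prop), lintegral_prod _ (by fun_prop),
    lintegral_prod _ (by fun_prop), lintegral_prod _ (by fun_prop)]
  refine lintegral_congr fun x => ?_
  have h1 : ∀ y, ∫⁻ z, f ((x, z.1), (y, z.2)) ∂(μ₃.prod μ₄) =
      ∫⁻ z, ∫⁻ w, f ((x, z), (y, w)) ∂μ₄ ∂μ₃ := fun y => lintegral_prod _ (by fun_prop)
  have h2 : ∀ y, ∫⁻ z, f ((x, y), z) ∂(μ₂.prod μ₄) =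
      ∫⁻ z, ∫⁻ w, f ((x, y), (z, w)) ∂μ₄ ∂μ₂ := fun y => lintegral_prod _ (by fun_prop)
  simp only [h1, h2]
  refine lintegral_lintegral_swap (Measurable.aemeasurable ?_)
  exact Measurable.lintegral_prod_right' (f := fun q : (β × γ) × δ => f ((x, q.1.2), (q.1.1, q.2)))
    (by fun_prop)

/-- Concatenation of times and of marks. -/
def appendLayers (k l : ℕ) (q : ((Fin k → ℝ) × (Fin k → ℝ)) × ((Fin l → ℝ) × (Fin l → ℝ))) :
    (Fin (k + l) → ℝ) × (Fin (k + l) → ℝ) :=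
  (Fin.append q.1.1 q.2.1, Fin.append q.1.2 q.2.2)

lemma volume_preserving_appendLayers (k l : ℕ) : MeasurePreserving (appendLayers k l) := by
  have h1 : MeasurePreserving (fun q : ((Fin k → ℝ) × (Fin k → ℝ)) × ((Fin l → ℝ) × (Fin l → ℝ)) =>
      ((q.1.1, q.2.1), (q.1.2, q.2.2))) := ⟨by fun_prop, map_prodProdProdComm _ _ _ _⟩
  exact ((volume_preserving_fin_append k l).prod (volume_preserving_fin_append k l)).comp h1

/-- The configurations on `(a, c]` with `k` points up to time `b` and `l` points after it. -/
def splitSet (a b c : ℝ) (k l : ℕ) : Set MarkedPoints :=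
  {x | x.count = k + l ∧ IsConfig a c x ∧ ∀ j, x.times j ≤ b ↔ j.val < k}

lemma measurableSet_splitSet (a b c : ℝ) (k l : ℕ) : MeasurableSet (splitSet a b c k l) := by
  have h := Config.measurableSet_isConfig a c
  rw [measurableSet_iff] at h ⊢
  intro n
  by_cases hn : n = k + l
  · have h' : layer n ⁻¹' splitSet a b c k l = layer n ⁻¹' {x | IsConfig a c x} ∩
        ⋂ j : Fin n, {p | p.1 j ≤ b ↔ j.val < k} := by
      ext p
      simp only [splitSet, layer, Set.mem_preimage, Set.mem_ofPred_eq, Set.mem_inter_iff, Set.mem_iInter]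
      exact ⟨fun h => h.2, fun h => ⟨hn, h⟩⟩
    rw [h']
    refine (h n).inter (.iInter fun j => ?_)
    by_cases hj : j.val < k
    · simp only [hj, iff_true]
      exact measurableSet_le (by fun_prop) measurable_const
    · simp only [hj, iff_false, not_le]
      exact measurableSet_lt measurable_const (by fun_prop)
  · have h' : layer n ⁻¹' splitSet a b c k l = ∅ :=
      Set.eq_empty_of_forall_notMem fun p hp => hn hp.1
    rw [h']
    exact .empty

lemma pairwise_disjoint_splitSet (a b c : ℝ) :
    Pairwise (Function.onFun Disjoint fun q : ℕ × ℕ => splitSet a b c q.1 q.2) := by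
  have key : ∀ (k l k' l' : ℕ) (x : MarkedPoints), x ∈ splitSet a b c k l →
      x ∈ splitSet a b c k' l' → k' ≤ k := by
    rintro k l k' l' x ⟨h₁, -, h₂⟩ ⟨h₁', -, h₂'⟩
    by_contra! hlt
    have hj : k < x.count := by omega
    exact absurd ((h₂ ⟨k, hj⟩).1 ((h₂' ⟨k, hj⟩).2 hlt)) (lt_irrefl k)
  rintro ⟨k, l⟩ ⟨k', l'⟩ hne
  refine Set.disjoint_left.2 fun x hx hx' => hne ?_
  have h₁ := key _ _ _ _ x hx hx'
  have h₂ := key _ _ _ _ x hx' hx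
  have h₃ := hx.1
  have h₄ := hx'.1
  simp only [Prod.mk.injEq]
  simp only at h₁ h₂ h₃ h₄
  omega

lemma exists_forall_le_iff_val_lt {n : ℕ} {φ : Fin n → ℝ} (hφ : StrictMono φ) (b : ℝ) :
    ∃ k ≤ n, ∀ j, φ j ≤ b ↔ j.val < k := by
  induction n with
  | zero => exact ⟨0, le_rfl, fun j => j.elim0⟩
  | succ n ih =>
    obtain ⟨k, hk, h⟩ := ih (φ := fun i => φ i.castSucc) (hφ.comp Fin.strictMono_castSucc)
    by_cases hl : φ (Fin.last n) ≤ b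
    · exact ⟨n + 1, le_rfl, fun j => ⟨fun _ => j.2, fun _ =>
        (hφ.monotone (Fin.le_last j)).trans hl⟩⟩
    · refine ⟨k, hk.trans n.le_succ, fun j => ?_⟩
      induction j using Fin.lastCases with
      | last => simpa [hl] using hk
      | cast j => exact h j

lemma iUnion_splitSet (a b c : ℝ) :
    ⋃ q : ℕ × ℕ, splitSet a b c q.1 q.2 = {x | IsConfig a c x} := by
  ext x
  simp only [Set.mem_iUnion, Set.mem_ofPred_eq]
  constructor
  · rintro ⟨q, hq⟩
    exact hq.2.1
  · intro h
    obtain ⟨k, hk, hj⟩ := exists_forall_le_iff_val_lt h.1 b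
    exact ⟨(k, x.count - k), by simp only; omega, h, hj⟩

lemma isConfig_layer_iff {a b : ℝ} {k : ℕ} {p : (Fin k → ℝ) × (Fin k → ℝ)} :
    IsConfig a b (layer k p) ↔
      StrictMono p.1 ∧ (∀ j, a < p.1 j ∧ p.1 j ≤ b) ∧ ∀ j, 0 < p.2 j := Iff.rfl

lemma append_mem_splitSet {a b c : ℝ} (hab : a ≤ b) (hbc : b ≤ c) {k l : ℕ}
    (p : (Fin k → ℝ) × (Fin k → ℝ)) (p' : (Fin l → ℝ) × (Fin l → ℝ)) :
    layer (k + l) (appendLayers k l (p, p')) ∈ splitSet a b c k l ↔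
      IsConfig a b (layer k p) ∧ IsConfig b c (layer l p') := by
  constructor
  · rintro ⟨-, h, h₄⟩
    rw [isConfig_layer_iff] at h
    obtain ⟨h₁, h₂, h₃⟩ := h
    change ∀ j : Fin (k + l), Fin.append p.1 p'.1 j ≤ b ↔ j.val < k at h₄
    simp only [appendLayers] at h₁ h₂ h₃
    rw [isConfig_layer_iff, isConfig_layer_iff]
    refine ⟨⟨fun i j hij => ?_, fun j => ⟨?_, ?_⟩, fun j => ?_⟩,
      ⟨fun i j hij => ?_, fun j => ⟨?_, ?_⟩, fun j => ?_⟩⟩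
    · simpa using h₁ (show Fin.castAdd l i < Fin.castAdd l j from hij)
    · simpa using (h₂ (Fin.castAdd l j)).1
    · simpa using (h₄ (Fin.castAdd l j)).2 j.2
    · simpa using h₃ (Fin.castAdd l j)
    · simpa using h₁ (show Fin.natAdd k i < Fin.natAdd k j from Nat.add_lt_add_left hij k)
    · have := (h₄ (Fin.natAdd k j)).not.2 (by simp)
      simpa using this
    · simpa using (h₂ (Fin.natAdd k j)).2
    · simpa using h₃ (Fin.natAdd k j)
  · rintro ⟨h, h'⟩
    refine ⟨rfl, h.append hab hbc h', ?_⟩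
    rw [isConfig_layer_iff] at h h'
    change ∀ j : Fin (k + l), Fin.append p.1 p'.1 j ≤ b ↔ j.val < k
    intro j
    induction j using Fin.addCases with
    | left j => simpa using (h.2.1 j).2
    | right j => simpa using (h'.2.1 j).1

lemma lebesgue_restrict_splitSet (a b c : ℝ) (k l : ℕ) :
    lebesgue.restrict (splitSet a b c k l) =
      ((volume : Measure ((Fin (k + l) → ℝ) × (Fin (k + l) → ℝ))).map (layer (k + l))).restrict
        (splitSet a b c k l) := by
  ext s hs
  have hm := hs.inter (measurableSet_splitSet a b c k l)
  rw [Measure.restrict_apply hs, Measure.restrict_apply hs, lebesgue, Measure.sum_apply _ hm,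
    tsum_eq_single (k + l)]
  intro n hn
  rw [(measurableEmbedding_layer n).map_apply]
  have : layer n ⁻¹' (s ∩ splitSet a b c k l) = ∅ :=
    Set.eq_empty_of_forall_notMem fun p hp => hn hp.2.1
  rw [this, measure_empty]

lemma map_append_lebesgue {a b c : ℝ} (hab : a ≤ b) (hbc : b ≤ c) :
    ((lebesgue.restrict {x | IsConfig a b x}).prod (lebesgue.restrict {x | IsConfig b c x})).map
      (fun z => z.1.append z.2) = lebesgue.restrict {x | IsConfig a c x} := by
  have hAB := (Config.measurableSet_isConfig a b).prod (Config.measurableSet_isConfig b c)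
  rw [← iUnion_splitSet a b c, Measure.restrict_iUnion (pairwise_disjoint_splitSet a b c)
    (fun q => measurableSet_splitSet a b c q.1 q.2), Measure.prod_restrict]
  conv_lhs => rw [lebesgue, Measure.prod_sum]
  rw [Measure.restrict_sum _ hAB, Measure.map_sum measurable_append.aemeasurable]
  congr 1
  funext q
  obtain ⟨k, l⟩ := q
  have hl : Measurable (Prod.map (layer k) (layer l)) :=
    (measurableEmbedding_layer k).measurable.prodMap (measurableEmbedding_layer l).measurable
  simp only
  rw [lebesgue_restrict_splitSet, Measure.map_prod_map _ _ (measurableEmbedding_layer k).measurable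
    (measurableEmbedding_layer l).measurable, Measure.restrict_map hl hAB,
    Measure.map_map measurable_append hl, ← (volume_preserving_appendLayers k l).map_eq,
    Measure.map_map (measurableEmbedding_layer _).measurable
      (volume_preserving_appendLayers k l).measurable,
    Measure.restrict_map ((measurableEmbedding_layer _).measurable.comp
      (volume_preserving_appendLayers k l).measurable) (measurableSet_splitSet a b c k l)]
  have hpre : Prod.map (layer k) (layer l) ⁻¹' ({x | IsConfig a b x} ×ˢ {x | IsConfig b c x}) =
      (layer (k + l) ∘ appendLayers k l) ⁻¹' splitSet a b c k l := by
    ext ⟨p, p'⟩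
    exact (append_mem_splitSet hab hbc p p').symm
  rw [hpre]
  rfl

end MarkedPoints

lemma Config.map_points_lebesgue (a b : ℝ) : (Config.lebesgue a b).map Config.points =
    MarkedPoints.lebesgue.restrict {x | IsConfig a b x} := by
  rw [Config.lebesgue, Config.measurableEmbedding_points.map_comap]
  congr 1
  exact Subtype.range_coe

/-- A configuration on `(a, c]` is a configuration on `(a, b]` followed by one on `(b, c]`, and the
Lebesgue measure is the product measure. -/
theorem Config.map_concat_lebesgue {a b c : ℝ} (hab : a ≤ b) (hbc : b ≤ c) :
    ((Config.lebesgue a b).prod (Config.lebesgue b c)).map (fun z => z.1.concat hab hbc z.2) =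
      Config.lebesgue a c := by
  have h : (((Config.lebesgue a b).prod (Config.lebesgue b c)).map
      (fun z => z.1.concat hab hbc z.2)).map Config.points =
        (Config.lebesgue a c).map Config.points := by
    rw [map_points_lebesgue, ← MarkedPoints.map_append_lebesgue hab hbc, ← map_points_lebesgue,
      ← map_points_lebesgue,
      Measure.map_prod_map _ _ Config.measurable_points Config.measurable_points,
      Measure.map_map Config.measurable_points (Config.measurable_concat hab hbc),
      Measure.map_map MarkedPoints.measurable_append
        (Config.measurable_points.prodMap Config.measurable_points)]
    rfl
  rw [← Config.measurableEmbedding_points.comap_map (Config.lebesgue a c), ← h,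
    Config.measurableEmbedding_points.comap_map]

/-! ### The prior and the likelihood over consecutive intervals -/

lemma MarkedPoints.measurable_of_layer {β : Type*} [MeasurableSpace β] {f : MarkedPoints → β}
    (h : ∀ k, Measurable fun p => f (layer k p)) : Measurable f :=
  fun _ hs => measurableSet_iff.2 fun k => h k hs

/-- The prior density on an interval of length `d`, as a function of the marked points. -/
noncomputable def markedDensity (m : CoxModel) (d : ℝ) (x : MarkedPoints) : ℝ :=
  (Real.exp (-(m.ν * d)) * (m.ν * d) ^ x.count / x.count.factorial) *
    (d ^ x.count / x.count.factorial)⁻¹ * ∏ j, exponentialPDFReal (1 / m.γ) (x.marks j)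

lemma measurable_markedDensity (m : CoxModel) (d : ℝ) : Measurable (markedDensity m d) :=
  MarkedPoints.measurable_of_layer fun k => by
    have h : Measurable fun p : (Fin k → ℝ) × (Fin k → ℝ) =>
        (Real.exp (-(m.ν * d)) * (m.ν * d) ^ k / k.factorial) *
          (d ^ k / k.factorial)⁻¹ * ∏ j, exponentialPDFReal (1 / m.γ) (p.2 j) := by fun_prop
    exact h

lemma measurable_priorDensity (m : CoxModel) (a b : ℝ) : Measurable (priorDensity m a b) :=
  (measurable_markedDensity m (b - a)).comp Config.measurable_points

lemma priorDensity_nonneg (m : CoxModel) {a b : ℝ} (hab : a ≤ b) (x : Config a b) :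
    0 ≤ priorDensity m a b x := by
  have := m.ν_pos
  have := m.γ_pos
  have hd : 0 ≤ b - a := sub_nonneg.2 hab
  have h : 0 ≤ ∏ j, exponentialPDFReal (1 / m.γ) (x.points.marks j) :=
    Finset.prod_nonneg fun j _ => exponentialPDFReal_nonneg (by positivity) _
  unfold priorDensity
  positivity

/-- The prior density in closed form: the volume of the simplex of ordered times cancels. -/
lemma priorDensity_eq (m : CoxModel) {a b : ℝ} (hab : a < b) (x : Config a b) :
    priorDensity m a b x = Real.exp (-(m.ν * (b - a))) * m.ν ^ x.points.count *
      ∏ j, exponentialPDFReal (1 / m.γ) (x.points.marks j) := by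
  have hd : b - a ≠ 0 := (sub_pos.2 hab).ne'
  have hk : (x.points.count.factorial : ℝ) ≠ 0 := by exact_mod_cast Nat.factorial_ne_zero _
  unfold priorDensity
  congr 1
  rw [mul_pow]
  field_simp

/-- The Poisson prior over two consecutive intervals is a product. -/
lemma priorDensity_concat (m : CoxModel) {a b c : ℝ} (hab : a < b) (hbc : b < c)
    (x : Config a b) (x' : Config b c) :
    priorDensity m a c (x.concat hab.le hbc.le x') =
      priorDensity m a b x * priorDensity m b c x' := by
  rw [priorDensity_eq m (hab.trans hbc), priorDensity_eq m hab, priorDensity_eq m hbc]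
  obtain ⟨⟨k, φ, ζ⟩, hx⟩ := x
  obtain ⟨⟨l, φ', ζ'⟩, hx'⟩ := x'
  change Real.exp (-(m.ν * (c - a))) * m.ν ^ (k + l) *
      ∏ j : Fin (k + l), exponentialPDFReal (1 / m.γ) (Fin.append ζ ζ' j) =
    (Real.exp (-(m.ν * (b - a))) * m.ν ^ k * ∏ j, exponentialPDFReal (1 / m.γ) (ζ j)) *
      (Real.exp (-(m.ν * (c - b))) * m.ν ^ l * ∏ j, exponentialPDFReal (1 / m.γ) (ζ' j))
  have he : Real.exp (-(m.ν * (c - a))) =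
      Real.exp (-(m.ν * (b - a))) * Real.exp (-(m.ν * (c - b))) := by
    rw [← Real.exp_add]
    ring_nf
  rw [Fin.prod_univ_add, he]
  simp only [Fin.append_left, Fin.append_right]
  ring

/-- The simplex of ordered times has volume at most `(b - a) ^ k / k!`: its `k!` images under the
permutations of the coordinates are disjoint subsets of a cube. -/
lemma factorial_mul_volume_strictMono_le {a b : ℝ} (k : ℕ) :
    (k.factorial : ℝ≥0∞) *
        volume {φ : Fin k → ℝ | StrictMono φ ∧ ∀ j, a < φ j ∧ φ j ≤ b} ≤
      ENNReal.ofReal (b - a) ^ k := by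
  set S : Set (Fin k → ℝ) := {φ | StrictMono φ ∧ ∀ j, a < φ j ∧ φ j ≤ b} with hS
  have hSm : MeasurableSet S := by
    have h : S = (⋂ i, ⋂ j, ⋂ (_ : i < j), {φ | φ i < φ j}) ∩
        (⋂ j, {φ | a < φ j} ∩ {φ | φ j ≤ b}) := by
      ext φ
      simp only [hS, StrictMono, Set.mem_ofPred_eq, Set.mem_inter_iff, Set.mem_iInter]
    rw [h]
    refine .inter (.iInter fun i => .iInter fun j => .iInter fun _ => ?_)
      (.iInter fun j => .inter ?_ ?_)
    · exact measurableSet_lt (by fun_prop) (by fun_prop)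
    · exact measurableSet_lt (by fun_prop) (by fun_prop)
    · exact measurableSet_le (by fun_prop) (by fun_prop)
  let A : Equiv.Perm (Fin k) → Set (Fin k → ℝ) := fun σ => (fun φ i => φ (σ i)) ⁻¹' S
  have hmp : ∀ σ : Equiv.Perm (Fin k),
      MeasurePreserving (fun (φ : Fin k → ℝ) i => φ (σ i)) volume volume := by
    intro σ
    have h := volume_measurePreserving_piCongrLeft (fun _ : Fin k => ℝ) σ.symm
    convert h using 1
    ext φ i
    have := MeasurableEquiv.piCongrLeft_apply_apply σ.symm (β := fun _ : Fin k => ℝ) φ (σ i)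
    simpa using this.symm
  have hdisj : Pairwise (Function.onFun Disjoint A) := by
    intro σ ρ hne
    refine Set.disjoint_left.2 fun φ hσ hρ => hne ?_
    have hinj : Function.Injective φ := fun i j hij => by
      have h : Function.Injective fun i => φ (σ i) := StrictMono.injective hσ.1
      have := @h (σ.symm i) (σ.symm j) (by simpa using hij)
      simpa using this
    have h : (fun i => φ (σ i)) = fun i => φ (ρ i) := by
      refine StrictMono.range_inj (hσ.1 : StrictMono fun i => φ (σ i)) hρ.1 |>.1 ?_
      have e1 := σ.surjective.range_comp φ
      have e2 := ρ.surjective.range_comp φ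
      exact e1.trans e2.symm
    ext i
    exact congrArg _ (hinj (congrFun h i))
  have hsub : ⋃ σ, A σ ⊆ Set.univ.pi fun _ => Set.Ioc a b := by
    refine Set.iUnion_subset fun σ φ hφ j _ => ?_
    have := hφ.2 (σ.symm j)
    simpa using this
  calc (k.factorial : ℝ≥0∞) * volume S = ∑' σ : Equiv.Perm (Fin k), volume (A σ) := by
        simp only [A, (hmp _).measure_preimage hSm.nullMeasurableSet]
        rw [tsum_fintype, Finset.sum_const, Finset.card_univ, Fintype.card_perm, Fintype.card_fin,
          nsmul_eq_mul]
    _ ≤ volume (⋃ σ, A σ) :=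
        tsum_meas_le_meas_iUnion_of_disjoint _ (fun σ => (hmp σ).measurable hSm) hdisj
    _ ≤ volume (Set.univ.pi fun _ : Fin k => Set.Ioc a b) := measure_mono hsub
    _ = ENNReal.ofReal (b - a) ^ k := by
        rw [volume_pi_pi]
        simp

lemma lintegral_prod_exponentialPDFReal {r : ℝ} (hr : 0 < r) (k : ℕ) :
    ∫⁻ ζ : Fin k → ℝ, ENNReal.ofReal (∏ j, exponentialPDFReal r (ζ j)) = 1 := by
  have h1 : ∫ x, exponentialPDFReal r x = 1 := by
    rw [integral_eq_lintegral_of_nonneg_ae (.of_forall (exponentialPDFReal_nonneg hr))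
      (stronglyMeasurable_exponentialPDFReal r).aestronglyMeasurable]
    exact (congrArg ENNReal.toReal (lintegral_exponentialPDF_eq_one hr)).trans (by simp)
  have hi : Integrable (exponentialPDFReal r) := by
    by_contra h
    rw [integral_undef h] at h1
    exact zero_ne_one h1
  rw [← ofReal_integral_eq_lintegral_ofReal, integral_fintype_prod_volume_eq_pow, h1]
  · simp
  · exact Integrable.fintype_prod (f := fun _ => exponentialPDFReal r) fun _ => hi
  · exact .of_forall fun ζ => Finset.prod_nonneg fun j _ => exponentialPDFReal_nonneg hr _

/-- The prior is a probability measure; only this upper bound is needed, and it avoids the exact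
volume of the simplex. -/
lemma prior_univ_le_one (m : CoxModel) {a b : ℝ} (hab : a < b) : prior m a b Set.univ ≤ 1 := by
  have hd : 0 < b - a := sub_pos.2 hab
  have hν := m.ν_pos
  have hγ : 0 < 1 / m.γ := one_div_pos.2 m.γ_pos
  have hF : Measurable fun x => ENNReal.ofReal (markedDensity m (b - a) x) :=
    (measurable_markedDensity m (b - a)).ennreal_ofReal
  have hconf := Config.measurableSet_isConfig a b
  set w : ℕ → ℝ := fun k => (Real.exp (-(m.ν * (b - a))) * (m.ν * (b - a)) ^ k / k.factorial) *
    ((b - a) ^ k / k.factorial)⁻¹ with hw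
  have hw0 : ∀ k, 0 ≤ w k := fun k => by positivity
  have hterm : ∀ k, ∫⁻ p in MarkedPoints.layer k ⁻¹' {x | IsConfig a b x},
      ENNReal.ofReal (markedDensity m (b - a) (MarkedPoints.layer k p)) ≤
        ENNReal.ofReal (Real.exp (-(m.ν * (b - a))) * ((m.ν * (b - a)) ^ k / k.factorial)) := by
    intro k
    set S : Set (Fin k → ℝ) := {φ | StrictMono φ ∧ ∀ j, a < φ j ∧ φ j ≤ b} with hS
    have hvol : volume S ≤ ENNReal.ofReal ((b - a) ^ k / k.factorial) := by
      rw [ENNReal.ofReal_div_of_pos (by positivity), ENNReal.ofReal_pow hd.le,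
        ENNReal.ofReal_natCast, ENNReal.le_div_iff_mul_le (by simp [Nat.factorial_ne_zero])
        (by simp), mul_comm]
      exact factorial_mul_volume_strictMono_le k
    have hmd : Measurable fun p : (Fin k → ℝ) × (Fin k → ℝ) =>
        ENNReal.ofReal (w k * ∏ j, exponentialPDFReal (1 / m.γ) (p.2 j)) := by fun_prop
    calc ∫⁻ p in MarkedPoints.layer k ⁻¹' {x | IsConfig a b x},
          ENNReal.ofReal (markedDensity m (b - a) (MarkedPoints.layer k p))
        ≤ ∫⁻ p : (Fin k → ℝ) × (Fin k → ℝ) in S ×ˢ Set.univ,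
          ENNReal.ofReal (w k * ∏ j, exponentialPDFReal (1 / m.γ) (p.2 j)) :=
          lintegral_mono_set fun p hp => ⟨⟨hp.1, hp.2.1⟩, trivial⟩
      _ = volume S * ENNReal.ofReal (w k) := by
          rw [Measure.volume_eq_prod, ← Measure.prod_restrict, Measure.restrict_univ,
            lintegral_prod _ hmd.aemeasurable]
          simp only [ENNReal.ofReal_mul (hw0 k)]
          rw [lintegral_const_mul _ (by fun_prop), lintegral_prod_exponentialPDFReal hγ, mul_one,
            lintegral_const, Measure.restrict_apply_univ, mul_comm]
      _ ≤ ENNReal.ofReal ((b - a) ^ k / k.factorial) * ENNReal.ofReal (w k) := by gcongr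
      _ = _ := by
          rw [← ENNReal.ofReal_mul (by positivity)]
          congr 1
          simp only [hw]
          field_simp
  calc prior m a b Set.univ
      = ∫⁻ x : Config a b, ENNReal.ofReal (markedDensity m (b - a) x.points)
          ∂(Config.lebesgue a b) := by
        rw [prior, withDensity_apply _ .univ, Measure.restrict_univ]
        rfl
    _ = ∫⁻ x in {x | IsConfig a b x}, ENNReal.ofReal (markedDensity m (b - a) x)
          ∂MarkedPoints.lebesgue := by
        rw [← Config.map_points_lebesgue, lintegral_map hF Config.measurable_points]
    _ = ∑' k : ℕ, ∫⁻ p in MarkedPoints.layer k ⁻¹' {x | IsConfig a b x},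
          ENNReal.ofReal (markedDensity m (b - a) (MarkedPoints.layer k p)) := by
        rw [MarkedPoints.lebesgue, Measure.restrict_sum _ hconf, lintegral_sum_measure]
        refine tsum_congr fun k => ?_
        rw [Measure.restrict_map (MarkedPoints.measurableEmbedding_layer k).measurable hconf,
          lintegral_map hF (MarkedPoints.measurableEmbedding_layer k).measurable]
    _ ≤ ∑' k : ℕ,
          ENNReal.ofReal (Real.exp (-(m.ν * (b - a))) * ((m.ν * (b - a)) ^ k / k.factorial)) :=
        ENNReal.tsum_le_tsum hterm
    _ = 1 := by
        have hs : HasSum (fun k : ℕ => (m.ν * (b - a)) ^ k / k.factorial)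
            (Real.exp (m.ν * (b - a))) := by
          rw [Real.exp_eq_exp_ℝ]
          exact NormedSpace.expSeries_div_hasSum_exp _
        rw [← ENNReal.ofReal_tsum_of_nonneg (fun k => by positivity) (hs.mul_left _).summable,
          (hs.mul_left _).tsum_eq, ← Real.exp_add]
        simp

lemma measurable_likelihood (m : CoxModel) (y : Observations) (a b : ℝ) :
    Measurable fun x : Config 0 b => likelihood m y a b x := by
  have h1 : Measurable fun q : Config 0 b × ℝ => m.intensity q.1.points q.2 :=
    m.measurable_intensity.comp
      ((Config.measurable_points.comp measurable_fst).prodMk measurable_snd)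
  have h2 : ∀ u, Measurable fun x : Config 0 b => m.intensity x.points u := fun u =>
    h1.comp (measurable_id.prodMk measurable_const)
  have h3 : ∀ s : Set ℝ, Measurable fun x : Config 0 b => ∫ u in s, m.intensity x.points u :=
    fun s => (h1.stronglyMeasurable.integral_prod_right'
      (ν := (volume : Measure ℝ).restrict s)).measurable
  unfold likelihood intervalIntegral
  exact (Finset.measurable_fun_prod _ fun i _ => (h2 _).const_mul _).mul
    (((h3 _).sub (h3 _)).neg.exp)

lemma likelihood_nonneg (m : CoxModel) (y : Observations) {a b : ℝ} (ha : 0 ≤ a)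
    (x : Config 0 b) : 0 ≤ likelihood m y a b x := by
  refine mul_nonneg (Finset.prod_nonneg fun i hi => ?_) (Real.exp_nonneg _)
  rw [Finset.mem_filter] at hi
  refine mul_nonneg ?_ (m.intensity_nonneg b x _ (ha.trans hi.2.1.le) hi.2.2)
  unfold cauchyPDFReal
  positivity

/-- The likelihood factorises over consecutive intervals because the intensity up to time `b` does
not depend on the points after `b`. -/
lemma likelihood_concat (m : CoxModel) (y : Observations) {b c : ℝ} (hb : 0 ≤ b) (hbc : b ≤ c)
    (x : Config 0 b) (x' : Config b c) :
    likelihood m y 0 c (x.concat hb hbc x') =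
      likelihood m y 0 b x * likelihood m y b c (x.concat hb hbc x') := by
  set z := x.concat hb hbc x' with hz
  have hI := m.intervalIntegrable_intensity c z (hb.trans hbc)
  have h1 : IntervalIntegrable (m.intensity z.points) volume 0 b :=
    hI.mono_set (by rw [Set.uIcc_of_le hb, Set.uIcc_of_le (hb.trans hbc)]
                    exact Set.Icc_subset_Icc le_rfl hbc)
  have h2 : IntervalIntegrable (m.intensity z.points) volume b c :=
    hI.mono_set (by rw [Set.uIcc_of_le hbc, Set.uIcc_of_le (hb.trans hbc)]
                    exact Set.Icc_subset_Icc hb le_rfl)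
  have h3 : ∫ u in (0 : ℝ)..b, m.intensity z.points u = ∫ u in (0 : ℝ)..b, m.intensity x.points u :=
    intervalIntegral.integral_congr fun u hu => by
      rw [Set.uIcc_of_le hb] at hu
      exact m.intensity_concat b c hb hbc x x' u hu.1 hu.2
  have hfil : (Finset.univ.filter fun i => 0 < y.ω i ∧ y.ω i ≤ c) =
      (Finset.univ.filter fun i => 0 < y.ω i ∧ y.ω i ≤ b) ∪
        Finset.univ.filter fun i => b < y.ω i ∧ y.ω i ≤ c := by
    ext i
    simp only [Finset.mem_filter, Finset.mem_univ, true_and, Finset.mem_union]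
    constructor
    · rintro ⟨h, h'⟩
      rcases le_or_gt (y.ω i) b with hi | hi
      · exact .inl ⟨h, hi⟩
      · exact .inr ⟨hi, h'⟩
    · rintro (⟨h, h'⟩ | ⟨h, h'⟩)
      · exact ⟨h, h'.trans hbc⟩
      · exact ⟨hb.trans_lt h, h'⟩
  have hdis : Disjoint (Finset.univ.filter fun i => 0 < y.ω i ∧ y.ω i ≤ b)
      (Finset.univ.filter fun i => b < y.ω i ∧ y.ω i ≤ c) :=
    Finset.disjoint_filter.2 fun i _ hi hi' => absurd hi.2 (not_le.2 hi'.1)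
  unfold likelihood
  rw [hfil, Finset.prod_union hdis, ← intervalIntegral.integral_add_adjacent_intervals h1 h2, h3,
    neg_add, Real.exp_add]
  have h4 : ∏ i with 0 < y.ω i ∧ y.ω i ≤ b,
      cauchyPDFReal m.μ m.σ (y.ξ i) * m.intensity z.points (y.ω i) =
        ∏ i with 0 < y.ω i ∧ y.ω i ≤ b,
          cauchyPDFReal m.μ m.σ (y.ξ i) * m.intensity x.points (y.ω i) := by
    refine Finset.prod_congr rfl fun i hi => ?_
    rw [Finset.mem_filter] at hi
    rw [hz, m.intensity_concat b c hb hbc x x' _ hi.2.1.le hi.2.2]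
  rw [h4]
  ring

/-! ### The recursion for the posteriors -/

lemma measurable_extend (τ : InferenceTimes) (n : ℕ) : Measurable (extend τ n) :=
  Config.measurable_concat (τ.nonneg n) (τ.le_succ n)

lemma measurable_incrementWeight (m : CoxModel) (y : Observations) (τ : InferenceTimes) (n : ℕ) :
    Measurable (incrementWeight m y τ n) :=
  (((measurable_likelihood m y _ _).comp (measurable_extend τ n)).mul
    ((measurable_priorDensity m _ _).comp measurable_snd)).ennreal_ofReal

lemma withDensity_map_eq {α β : Type*} [MeasurableSpace α] [MeasurableSpace β] (μ : Measure α)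
    {g : α → β} (hg : Measurable g) {F : β → ℝ≥0∞} (hF : Measurable F) :
    (μ.map g).withDensity F = (μ.withDensity fun z => F (g z)).map g := by
  ext s hs
  rw [withDensity_apply _ hs, Measure.map_apply hg hs, withDensity_apply _ (hg hs),
    setLIntegral_map hs hF hg]

/-- The unnormalised posterior at the next inference time: the current one is reweighted by the
likelihood of the new events and the prior of the new points. -/
lemma unnormalizedPosterior_succ (m : CoxModel) (y : Observations) (τ : InferenceTimes) {n : ℕ}
    (hn : 1 ≤ n) :
    unnormalizedPosterior m y (τ.time (n + 1)) =
      (((unnormalizedPosterior m y (τ.time n)).prod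
        (Config.lebesgue (τ.time n) (τ.time (n + 1)))).withDensity
          (incrementWeight m y τ n)).map (extend τ n) := by
  have h0 : 0 < τ.time n := τ.time_zero ▸ τ.strictMono (Nat.pos_of_ne_zero (by omega))
  have h1 : τ.time n < τ.time (n + 1) := τ.strictMono n.lt_succ_self
  have hF : ∀ b : ℝ, Measurable fun x : Config 0 b =>
      ENNReal.ofReal (likelihood m y 0 b x * priorDensity m 0 b x) := fun b =>
    ((measurable_likelihood m y 0 b).mul (measurable_priorDensity m 0 b)).ennreal_ofReal
  have hw := measurable_incrementWeight m y τ n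
  have he := measurable_extend τ n
  have hfac : ∀ z : State τ n × Increment τ n,
      ENNReal.ofReal (likelihood m y 0 (τ.time (n + 1)) (extend τ n z) *
        priorDensity m 0 (τ.time (n + 1)) (extend τ n z)) =
      ENNReal.ofReal (likelihood m y 0 (τ.time n) z.1 * priorDensity m 0 (τ.time n) z.1) *
        incrementWeight m y τ n z := by
    intro z
    have h2 : priorDensity m 0 (τ.time (n + 1)) (extend τ n z) = _ :=
      priorDensity_concat m h0 h1 z.1 z.2
    have h3 : likelihood m y 0 (τ.time (n + 1)) (extend τ n z) = _ :=
      likelihood_concat m y h0.le h1.le z.1 z.2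
    rw [incrementWeight, ← ENNReal.ofReal_mul (mul_nonneg (likelihood_nonneg m y le_rfl _)
      (priorDensity_nonneg m h0.le _)), h2, h3]
    congr 1
    unfold extend
    ring
  have hleb : Config.lebesgue 0 (τ.time (n + 1)) = ((Config.lebesgue 0 (τ.time n)).prod
      (Config.lebesgue (τ.time n) (τ.time (n + 1)))).map (extend τ n) :=
    (Config.map_concat_lebesgue h0.le h1.le).symm
  rw [unnormalizedPosterior, unnormalizedPosterior, prod_withDensity_left (hF _),
    hleb, withDensity_map_eq _ he (hF _),
    ← withDensity_mul _ (f := fun z : State τ n × Increment τ n =>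
      ENNReal.ofReal (likelihood m y 0 (τ.time n) z.1 * priorDensity m 0 (τ.time n) z.1))
      ((hF _).comp measurable_fst) hw]
  congr 2
  funext z
  exact hfac z

section Recursion

variable {m : CoxModel} {y : Observations} {τ : InferenceTimes}

lemma unnormalizedPosterior_univ (b : ℝ) :
    unnormalizedPosterior m y b Set.univ = evidence m y b := rfl

lemma isProbabilityMeasure_posterior {n : ℕ} (h0 : 0 < evidence m y (τ.time n))
    (h1 : evidence m y (τ.time n) < ∞) : IsProbabilityMeasure (posterior m y τ n) := by
  constructor
  rw [posterior, Measure.smul_apply, unnormalizedPosterior_univ, smul_eq_mul,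
    ENNReal.inv_mul_cancel h0.ne' h1.ne]

instance (b : ℝ) : SFinite (unnormalizedPosterior m y b) := by
  unfold unnormalizedPosterior
  infer_instance

lemma map_extend_posterior {n : ℕ} (hn : 1 ≤ n) :
    (((posterior m y τ n).prod (Config.lebesgue (τ.time n) (τ.time (n + 1)))).withDensity
      (incrementWeight m y τ n)).map (extend τ n) =
        (evidence m y (τ.time n))⁻¹ • unnormalizedPosterior m y (τ.time (n + 1)) := by
  rw [unnormalizedPosterior_succ m y τ hn, posterior, Measure.prod_smul_left,
    withDensity_smul_measure, Measure.map_smul]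

/-- The predictive density is the ratio of two consecutive normalising constants. -/
lemma predictive_eq {n : ℕ} (hn : 1 ≤ n) :
    predictive m y τ n =
      (evidence m y (τ.time n))⁻¹ * evidence m y (τ.time (n + 1)) := by
  have h := congrArg (fun μ : Measure (State τ (n + 1)) => μ Set.univ)
    (map_extend_posterior (m := m) (y := y) (τ := τ) hn)
  simp only [Measure.map_apply (measurable_extend τ n) .univ, Set.preimage_univ,
    withDensity_apply _ MeasurableSet.univ, Measure.restrict_univ, Measure.smul_apply,
    smul_eq_mul, unnormalizedPosterior_univ] at h
  have : SFinite (posterior m y τ n) := by unfold posterior; infer_instance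
  rw [← h, lintegral_prod _ (measurable_incrementWeight m y τ n).aemeasurable]
  rfl

lemma measurable_filteringWeight (n : ℕ) : Measurable (filteringWeight m y τ n) :=
  (measurable_incrementWeight m y τ n).div_const _

variable (m y τ) in
/-- The kernel of density `g_{n+1}` with respect to the Lebesgue measure on the new points. -/
noncomputable def filteringKernel (n : ℕ) : Kernel (State τ n) (Increment τ n) :=
  (Kernel.const _ (Config.lebesgue (τ.time n) (τ.time (n + 1)))).withDensity
    fun x x' => filteringWeight m y τ n (x, x')

lemma filteringKernel_univ (n : ℕ) (x : State τ n) :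
    filteringKernel m y τ n x Set.univ =
      ∫⁻ x', filteringWeight m y τ n (x, x') ∂(Config.lebesgue (τ.time n) (τ.time (n + 1))) := by
  have h : Measurable (Function.uncurry fun x x' => filteringWeight m y τ n (x, x')) :=
    measurable_filteringWeight n
  rw [filteringKernel, Kernel.withDensity_apply' _ h,
    Measure.restrict_univ, Kernel.const_apply]

lemma isFiniteKernel_filteringKernel {n : ℕ} {c : ℝ≥0∞} (hc : c < ∞)
    (h : ∀ x, filteringKernel m y τ n x Set.univ ≤ c) :
    IsFiniteKernel (filteringKernel m y τ n) :=
  ⟨c, hc, h⟩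

/-- The weighted extension of `S` is, up to the factor `p_{n+1}`, the composition of `S` and the
filtering kernel. -/
lemma map_extend_eq_smul {n : ℕ} [IsFiniteKernel (filteringKernel m y τ n)]
    (h0 : predictive m y τ n ≠ 0) (h1 : predictive m y τ n ≠ ∞) (S : Measure (State τ n))
    [SFinite S] :
    ((S.prod (Config.lebesgue (τ.time n) (τ.time (n + 1)))).withDensity
      (incrementWeight m y τ n)).map (extend τ n) =
        predictive m y τ n • (S ⊗ₘ filteringKernel m y τ n).map (extend τ n) := by
  have hw := measurable_incrementWeight m y τ n
  have : IsSFiniteKernel ((Kernel.const (State τ n)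
      (Config.lebesgue (τ.time n) (τ.time (n + 1)))).withDensity
        fun x x' => filteringWeight m y τ n (x, x')) :=
    inferInstanceAs (IsSFiniteKernel (filteringKernel m y τ n))
  have hg : Measurable (Function.uncurry fun x x' => filteringWeight m y τ n (x, x')) :=
    measurable_filteringWeight n
  have h : (fun p : State τ n × Increment τ n => filteringWeight m y τ n (p.1, p.2)) =
      (predictive m y τ n)⁻¹ • incrementWeight m y τ n := by
    funext p
    rw [Pi.smul_apply, smul_eq_mul, filteringWeight, div_eq_mul_inv, mul_comm]
  rw [filteringKernel, Measure.compProd_withDensity hg,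
    Measure.compProd_const, h, withDensity_smul _ hw, Measure.map_smul, smul_smul,
    ENNReal.mul_inv_cancel h0 h1, one_smul]

lemma posterior_succ {n : ℕ} [IsFiniteKernel (filteringKernel m y τ n)] (hn : 1 ≤ n)
    (h0 : 0 < evidence m y (τ.time n))
    (h1 : evidence m y (τ.time n) < ∞) (h0' : 0 < evidence m y (τ.time (n + 1)))
    (h1' : evidence m y (τ.time (n + 1)) < ∞) :
    posterior m y τ (n + 1) =
      (posterior m y τ n ⊗ₘ filteringKernel m y τ n).map (extend τ n) := by
  have hp0 : predictive m y τ n ≠ 0 := by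
    rw [predictive_eq hn]
    exact mul_ne_zero (ENNReal.inv_ne_zero.2 h1.ne) h0'.ne'
  have hp1 : predictive m y τ n ≠ ∞ := by
    rw [predictive_eq hn]
    exact ENNReal.mul_ne_top (ENNReal.inv_ne_top.2 h0.ne') h1'.ne
  have := isProbabilityMeasure_posterior h0 h1
  have h := map_extend_eq_smul hp0 hp1 (posterior m y τ n)
  rw [map_extend_posterior hn] at h
  have h2 := congrArg (fun μ => (predictive m y τ n)⁻¹ • μ) h
  simp only [smul_smul] at h2
  rw [ENNReal.inv_mul_cancel hp0 hp1, one_smul] at h2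
  rw [← h2, posterior, predictive_eq hn]
  congr 1
  rw [ENNReal.mul_inv (.inl (ENNReal.inv_ne_zero.2 h1.ne)) (.inl (ENNReal.inv_ne_top.2 h0.ne')),
    inv_inv, mul_right_comm, ENNReal.mul_inv_cancel h0.ne' h1.ne, one_mul]

end Recursion

/-! ### Integrals against the approximate posterior -/

section Empirical

variable {α : Type*} [MeasurableSpace α] {N : ℕ}

lemma isProbabilityMeasure_empirical (hN : 1 ≤ N) (χ : Fin N → α) :
    IsProbabilityMeasure (empirical χ) := by
  constructor
  simp only [empirical, Measure.smul_apply, Measure.finsetSum_apply, measure_univ,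
    Finset.sum_const, Finset.card_univ, Fintype.card_fin, smul_eq_mul, nsmul_eq_mul, mul_one]
  exact ENNReal.inv_mul_cancel (by simpa using Nat.one_le_iff_ne_zero.1 hN) (by simp)

lemma integral_empirical (χ : Fin N → α) {h : α → ℝ} (hm : Measurable h) :
    ∫ x, h x ∂(empirical χ) = (1 / (N : ℝ)) * ∑ i, h (χ i) := by
  have hi : ∀ i : Fin N, Integrable h (Measure.dirac (χ i)) := fun i => by
    refine integrable_dirac' hm.stronglyMeasurable ?_
    exact enorm_lt_top
  rw [empirical, integral_smul_measure, integral_finsetSum_measure fun i _ => hi i]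
  simp [integral_dirac' _ _ hm.stronglyMeasurable]

end Empirical

section FilteringOperator

variable {m : CoxModel} {y : Observations} {τ : InferenceTimes} {n : ℕ}

variable (m y τ n) in
/-- The function `x ↦ ∫ g_{n+1} (x, x') f (x, x') dx'` on `E_n`. -/
noncomputable def filteringOperator (f : State τ (n + 1) → ℝ) (x : State τ n) : ℝ :=
  ∫ x', f (extend τ n (x, x')) ∂(filteringKernel m y τ n x)

lemma measurable_filteringOperator [IsFiniteKernel (filteringKernel m y τ n)]
    {f : State τ (n + 1) → ℝ} (hf : Measurable f) :
    Measurable (filteringOperator m y τ n f) :=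
  (StronglyMeasurable.integral_kernel_prod_right' (κ := filteringKernel m y τ n)
    (f := fun z => f (extend τ n z))
    (hf.comp (measurable_extend τ n)).stronglyMeasurable).measurable

lemma filteringOperator_one (x : State τ n) :
    filteringOperator m y τ n (fun _ => 1) x = (filteringKernel m y τ n x).real Set.univ := by
  simp [filteringOperator]

lemma abs_filteringOperator_le [IsFiniteKernel (filteringKernel m y τ n)]
    {f : State τ (n + 1) → ℝ} {b : ℝ} (hfb : ∀ x, |f x| ≤ b) (x : State τ n) :
    |filteringOperator m y τ n f x| ≤ b * filteringOperator m y τ n (fun _ => 1) x := by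
  rw [filteringOperator_one]
  exact norm_integral_le_of_norm_le_const (μ := filteringKernel m y τ n x)
    (f := fun x' => f (extend τ n (x, x'))) (.of_forall fun x' => hfb _)

lemma integral_map_extend [IsFiniteKernel (filteringKernel m y τ n)] (S : Measure (State τ n))
    [IsFiniteMeasure S] {f : State τ (n + 1) → ℝ} (hf : Measurable f) {b : ℝ}
    (hfb : ∀ x, |f x| ≤ b) :
    ∫ x, f x ∂((S ⊗ₘ filteringKernel m y τ n).map (extend τ n)) =
      ∫ x, filteringOperator m y τ n f x ∂S := by
  have he := measurable_extend τ n
  rw [integral_map he.aemeasurable hf.aestronglyMeasurable]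
  refine Measure.integral_compProd (f := fun z => f (extend τ n z)) ?_
  exact .of_bound (hf.comp he).aestronglyMeasurable b (.of_forall fun z => hfb _)

lemma integral_posterior_succ [IsFiniteKernel (filteringKernel m y τ n)]
    (hn : 1 ≤ n) (h0 : 0 < evidence m y (τ.time n))
    (h1 : evidence m y (τ.time n) < ∞) (h0' : 0 < evidence m y (τ.time (n + 1)))
    (h1' : evidence m y (τ.time (n + 1)) < ∞) {f : State τ (n + 1) → ℝ} (hf : Measurable f)
    {b : ℝ} (hfb : ∀ x, |f x| ≤ b) :
    ∫ x, f x ∂(posterior m y τ (n + 1)) =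
      ∫ x, filteringOperator m y τ n f x ∂(posterior m y τ n) := by
  have := isProbabilityMeasure_posterior h0 h1
  rw [posterior_succ hn h0 h1 h0' h1', integral_map_extend _ hf hfb]

/-- `π_{n+1}^N` is the normalisation of the composition of the empirical measure and the filtering
kernel. -/
lemma approxPosterior_eq [IsFiniteKernel (filteringKernel m y τ n)]
    (h0 : predictive m y τ n ≠ 0) (h1 : predictive m y τ n ≠ ∞) {N : ℕ}
    (hN : 1 ≤ N) (χ : Fin N → State τ n) :
    approxPosterior m y τ n χ =
      ((empirical χ ⊗ₘ filteringKernel m y τ n).map (extend τ n) Set.univ)⁻¹ •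
        (empirical χ ⊗ₘ filteringKernel m y τ n).map (extend τ n) := by
  have := isProbabilityMeasure_empirical hN χ
  rw [approxPosterior, unnormalizedTarget, map_extend_eq_smul h0 h1, Measure.smul_apply,
    smul_eq_mul, smul_smul, ENNReal.mul_inv (.inl h0) (.inl h1), mul_right_comm,
    ENNReal.inv_mul_cancel h0 h1, one_mul]

/-- When the empirical average of `x ↦ ∫ g_{n+1} (x, x') dx'` does not vanish, `π_{n+1}^N` is a
probability measure, and integrals against it are ratios of empirical averages. -/
lemma approxPosterior_of_ne_zero [IsFiniteKernel (filteringKernel m y τ n)]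
    (h0 : predictive m y τ n ≠ 0) (h1 : predictive m y τ n ≠ ∞) {N : ℕ}
    (hN : 1 ≤ N) (χ : Fin N → State τ n)
    (ha : (1 / (N : ℝ)) * ∑ i, filteringOperator m y τ n (fun _ => 1) (χ i) ≠ 0) :
    IsProbabilityMeasure (approxPosterior m y τ n χ) ∧
      ∀ (f : State τ (n + 1) → ℝ) (b : ℝ), Measurable f → (∀ x, |f x| ≤ b) →
        ∫ x, f x ∂(approxPosterior m y τ n χ) =
          ((1 / (N : ℝ)) * ∑ i, filteringOperator m y τ n f (χ i)) /
            ((1 / (N : ℝ)) * ∑ i, filteringOperator m y τ n (fun _ => 1) (χ i)) := by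
  have := isProbabilityMeasure_empirical hN χ
  rw [approxPosterior_eq h0 h1 hN]
  set μ := (empirical χ ⊗ₘ filteringKernel m y τ n).map (extend τ n) with hμ
  have hint : ∀ (f : State τ (n + 1) → ℝ) (b : ℝ), Measurable f → (∀ x, |f x| ≤ b) →
      ∫ x, f x ∂μ = (1 / (N : ℝ)) * ∑ i, filteringOperator m y τ n f (χ i) := by
    intro f b hf hfb
    rw [hμ, integral_map_extend _ hf hfb, integral_empirical χ (measurable_filteringOperator hf)]
  have hmass : (μ Set.univ).toReal =
      (1 / (N : ℝ)) * ∑ i, filteringOperator m y τ n (fun _ => 1) (χ i) := by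
    rw [← hint _ 1 measurable_const fun _ => by simp]
    simp [Measure.real]
  have hμ0 : μ Set.univ ≠ 0 := fun h => ha (by rw [← hmass, h, ENNReal.toReal_zero])
  refine ⟨⟨?_⟩, fun f b hf hfb => ?_⟩
  · rw [Measure.smul_apply, smul_eq_mul, ENNReal.inv_mul_cancel hμ0 (measure_ne_top _ _)]
  · rw [integral_smul_measure, hint f b hf hfb, ENNReal.toReal_inv, hmass, smul_eq_mul,
      inv_mul_eq_div]

end FilteringOperator

/-! ### Propagation of the error through the steps of the algorithm -/

section Error

/-- The replacement of a ratio `F / a` of averages by the numerator costs at most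
`b |a - 1|` when `|F| ≤ b a`. -/
lemma abs_sub_le_of_ratio {A F a I b : ℝ} (ha : 0 < a) (hF : |F| ≤ b * a) :
    |A - I| ≤ |A - F / a| + 2 * b * |a - 1| + |F - I| := by
  have hb : 0 ≤ b := nonneg_of_mul_nonneg_left ((abs_nonneg F).trans hF) ha
  have h1 : |F / a - F| ≤ b * |a - 1| := by
    have h : F / a - F = F / a * (1 - a) := by field_simp
    rw [h, abs_mul, abs_sub_comm, abs_div, abs_of_pos ha]
    gcongr
    rwa [div_le_iff₀ ha]
  have h2 : |A - I| ≤ |A - F / a| + |F / a - F| + |F - I| := by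
    have := abs_add_three (A - F / a) (F / a - F) (F - I)
    simpa using this
  have h3 : 0 ≤ b * |a - 1| := by positivity
  linarith

lemma rpow_add_three_le {p u v w : ℝ} (hp : 0 ≤ p) (hu : 0 ≤ u) (hv : 0 ≤ v) (hw : 0 ≤ w) :
    (u + v + w) ^ p ≤ 3 ^ p * (u ^ p + v ^ p + w ^ p) := by
  set M := max u (max v w) with hM
  have hu' : u ≤ M := le_max_left _ _
  have hv' : v ≤ M := (le_max_left _ _).trans (le_max_right _ _)
  have hw' : w ≤ M := (le_max_right _ _).trans (le_max_right _ _)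
  have hu0 := Real.rpow_nonneg hu p
  have hv0 := Real.rpow_nonneg hv p
  have hw0 := Real.rpow_nonneg hw p
  calc (u + v + w) ^ p ≤ (3 * M) ^ p := Real.rpow_le_rpow (by positivity) (by linarith) hp
    _ = 3 ^ p * M ^ p := Real.mul_rpow (by norm_num) (hu.trans hu')
    _ ≤ _ := by
      gcongr
      rcases max_choice u (max v w) with h | h
      · rw [hM, h]; linarith
      · rcases max_choice v w with h' | h'
        · rw [hM, h, h']; linarith
        · rw [hM, h, h']; linarith

variable {m : CoxModel} {τ : InferenceTimes} {K : TransitionKernels τ}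

lemma initialDraw_univ_le_one (n : ℕ) {N : ℕ} (hN : 1 ≤ N) (χ : Fin N → State τ n) :
    initialDraw m τ n N χ Set.univ ≤ 1 := by
  have := isProbabilityMeasure_empirical hN χ
  have h : empiricalKernel (State τ n) N χ = empirical χ := rfl
  rw [initialDraw, Kernel.map_apply _ (measurable_extend τ n),
    Measure.map_apply (measurable_extend τ n) .univ, Set.preimage_univ, Kernel.prod_apply,
    Kernel.const_apply, h, ← Set.univ_prod_univ, Measure.prod_prod, measure_univ, one_mul]
  exact prior_univ_le_one m (τ.strictMono n.lt_succ_self)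

/-- A bound that holds for every initial state of the chain holds for the samples of a step. -/
lemma lintegral_samplesGiven_le (n : ℕ) {N : ℕ} (hN : 1 ≤ N) (χ : Fin N → State τ n)
    {φ : (Fin N → State τ (n + 1)) → ℝ≥0∞} (hφ : Measurable φ) {c : ℝ≥0∞}
    (h : ∀ x, ∫⁻ X, φ X ∂(chain (K.step n N) N (χ, x)) ≤ c) :
    ∫⁻ X, φ X ∂(samplesGiven K m n N χ) ≤ c := by
  have := K.isMarkovKernel_step n N
  have : IsSFiniteKernel (initialDraw m τ n N) := by unfold initialDraw; infer_instance
  rw [samplesGiven, Kernel.lintegral_comp _ _ _ hφ, Kernel.lintegral_id_prod hφ.lintegral_kernel]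
  calc _ ≤ ∫⁻ _, c ∂(initialDraw m τ n N χ) := lintegral_mono h
    _ ≤ c := by
      rw [lintegral_const]
      exact mul_le_of_le_one_right' (initialDraw_univ_le_one n hN χ)

lemma samplesLaw_univ_le_one {N : ℕ} (hN : 1 ≤ N) (x₁ : State τ 1) (n : ℕ) :
    samplesLaw K m N x₁ n Set.univ ≤ 1 := by
  have := K.isMarkovKernel_first
  match n with
  | 0 => simp [samplesLaw]
  | 1 =>
    rw [samplesLaw]
    exact prob_le_one
  | n + 2 =>
    rw [samplesLaw, Measure.bind_apply .univ (Kernel.aemeasurable _)]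
    calc _ ≤ ∫⁻ _, 1 ∂(samplesLaw K m N x₁ (n + 1)) := by
          refine lintegral_mono fun χ => ?_
          have := K.isMarkovKernel_step (n + 1) N
          have h := lintegral_samplesGiven_le (K := K) (m := m) (n + 1) hN χ
            (φ := fun _ => 1) (c := 1) measurable_const fun x => by simp
          simpa using h
      _ ≤ 1 := by simpa using samplesLaw_univ_le_one hN x₁ (n + 1)

variable {y : Observations} {M : ℕ}

/-- The conditional error of a step, given the samples `χ` of the previous one: the Markov chain
error, plus the errors of `χ` for the functions `∫ g dx'` and `∫ g f dx'`. -/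
lemma lintegral_samplesGiven_error_le {n N : ℕ} (hn : 1 ≤ n) (hN : 1 ≤ N)
    [IsFiniteKernel (filteringKernel m y τ n)]
    (h0 : 0 < evidence m y (τ.time n)) (h1 : evidence m y (τ.time n) < ∞)
    (h0' : 0 < evidence m y (τ.time (n + 1))) (h1' : evidence m y (τ.time (n + 1)) < ∞)
    (χ : Fin N → State τ n) (hinv : ((K.step n N).sectR χ).Invariant (approxPosterior m y τ n χ))
    {ε : ℝ} (hε : 0 < ε) {κ : Measure (Increment τ n)} [IsProbabilityMeasure κ]
    (hmin : ∀ x, ENNReal.ofReal ε • ((empirical χ).prod κ).map (extend τ n) ≤ K.step n N (χ, x))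
    {p : ℝ} (hp : 0 < p) {f : State τ (n + 1) → ℝ} (hf : Measurable f) {b : ℝ} (hb : 0 < b)
    (hfb : ∀ x, |f x| ≤ b) :
    ∫⁻ X, ENNReal.ofReal
        (|(1 / (N : ℝ)) * ∑ i, f (X i) - ∫ x, f x ∂(posterior m y τ (n + 1))| ^ p)
          ∂(samplesGiven K m n N χ) ≤
      ENNReal.ofReal (3 ^ p) *
        (ENNReal.ofReal (2 * Real.exp 2 * p ^ p * (2 / ε) ^ p * (b / √N) ^ p) +
          ENNReal.ofReal ((2 * b) ^ p) * ENNReal.ofReal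
            (|(1 / (N : ℝ)) * ∑ i, filteringOperator m y τ n (fun _ => 1) (χ i) -
              ∫ x, filteringOperator m y τ n (fun _ => 1) x ∂(posterior m y τ n)| ^ p) +
          ENNReal.ofReal
            (|(1 / (N : ℝ)) * ∑ i, filteringOperator m y τ n f (χ i) -
              ∫ x, filteringOperator m y τ n f x ∂(posterior m y τ n)| ^ p)) := by
  have hN0 : (0 : ℝ) < N := by exact_mod_cast hN
  have hp0 : predictive m y τ n ≠ 0 := by
    rw [predictive_eq hn]
    exact mul_ne_zero (ENNReal.inv_ne_zero.2 h1.ne) h0'.ne'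
  have hp1 : predictive m y τ n ≠ ∞ := by
    rw [predictive_eq hn]
    exact ENNReal.mul_ne_top (ENNReal.inv_ne_top.2 h0.ne') h1'.ne
  have hπ := isProbabilityMeasure_posterior h0' h1'
  have hχ := isProbabilityMeasure_empirical hN χ
  have hK := K.isMarkovKernel_step n N
  have hone : ∫ x, filteringOperator m y τ n (fun _ => 1) x ∂(posterior m y τ n) = 1 := by
    rw [← integral_posterior_succ (b := 1) hn h0 h1 h0' h1' measurable_const fun _ => by simp]
    simp
  rw [hone, ← integral_posterior_succ hn h0 h1 h0' h1' hf hfb]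
  set I := ∫ x, f x ∂(posterior m y τ (n + 1)) with hI
  set a := (1 / (N : ℝ)) * ∑ i, filteringOperator m y τ n (fun _ => 1) (χ i) with ha
  set F := (1 / (N : ℝ)) * ∑ i, filteringOperator m y τ n f (χ i) with hF
  refine lintegral_samplesGiven_le n hN χ (by fun_prop) fun x => ?_
  have ha0 : 0 ≤ a := by
    refine mul_nonneg (by positivity) (Finset.sum_nonneg fun i _ => ?_)
    rw [filteringOperator_one]
    positivity
  have hFa : |F| ≤ b * a := by
    rw [hF, ha, abs_mul, abs_of_pos (by positivity : 0 < 1 / (N : ℝ)), mul_left_comm,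
      Finset.mul_sum (a := b)]
    gcongr
    exact (Finset.abs_sum_le_sum_abs _ _).trans
      (Finset.sum_le_sum fun i _ => abs_filteringOperator_le hfb _)
  have hsplit : ∀ u v w : ℝ, 0 ≤ u → 0 ≤ v → 0 ≤ w →
      ENNReal.ofReal ((u + 2 * b * v + w) ^ p) ≤ ENNReal.ofReal (3 ^ p) *
        (ENNReal.ofReal (u ^ p) + ENNReal.ofReal ((2 * b) ^ p) * ENNReal.ofReal (v ^ p) +
          ENNReal.ofReal (w ^ p)) := by
    intro u v w hu hv hw
    have h := rpow_add_three_le hp.le hu (by positivity : 0 ≤ 2 * b * v) hw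
    rw [Real.mul_rpow (by positivity : 0 ≤ 2 * b) hv] at h
    rw [← ENNReal.ofReal_mul (by positivity), ← ENNReal.ofReal_add (by positivity) (by positivity),
      ← ENNReal.ofReal_add (by positivity) (by positivity), ← ENNReal.ofReal_mul (by positivity)]
    exact ENNReal.ofReal_le_ofReal h
  rcases ha0.eq_or_lt with ha' | ha'
  · -- The approximation `π_{n+1}^N` is degenerate; the error is at most `2 b = 2 b |a - 1|`.
    have hIb : |I| ≤ b := by
      have := norm_integral_le_of_norm_le_const (μ := posterior m y τ (n + 1)) (f := f)
        (.of_forall hfb)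
      simpa using this
    have hpt : ∀ X : Fin N → State τ (n + 1), |(1 / (N : ℝ)) * ∑ i, f (X i) - I| ≤ 2 * b := by
      intro X
      have h2 : |(1 / (N : ℝ)) * ∑ i, f (X i)| ≤ b := by
        rw [abs_mul, abs_of_pos (by positivity : 0 < 1 / (N : ℝ)), one_div, inv_mul_le_iff₀ hN0]
        refine (Finset.abs_sum_le_sum_abs _ _).trans ((Finset.sum_le_sum fun i _ => hfb _).trans ?_)
        simp
      exact (abs_sub _ _).trans (by linarith)
    calc _ ≤ ∫⁻ _, ENNReal.ofReal ((0 + 2 * b * |a - 1| + |F - I|) ^ p)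
          ∂(chain (K.step n N) N (χ, x)) := by
          refine lintegral_mono fun X => ENNReal.ofReal_le_ofReal
            (Real.rpow_le_rpow (abs_nonneg _) ((hpt X).trans ?_) hp.le)
          rw [← ha']
          simp
      _ ≤ _ := by
          rw [lintegral_const, measure_univ, mul_one]
          refine (hsplit 0 _ _ le_rfl (abs_nonneg _) (abs_nonneg _)).trans ?_
          gcongr
          rw [Real.zero_rpow hp.ne']
          positivity
  · obtain ⟨hprob, hint⟩ := approxPosterior_of_ne_zero hp0 hp1 hN χ ha'.ne'
    have hκ : IsProbabilityMeasure (((empirical χ).prod κ).map (extend τ n)) :=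
      Measure.isProbabilityMeasure_map (measurable_extend τ n).aemeasurable
    have hchain := lintegral_chain_average_le (K := K.step n N) χ hε hmin hinv hp hf hb hfb hN x
    rw [hint f b hf hfb] at hchain
    calc _ ≤ ∫⁻ X, ENNReal.ofReal (3 ^ p) *
          (ENNReal.ofReal (|(1 / (N : ℝ)) * ∑ i, f (X i) - F / a| ^ p) +
            ENNReal.ofReal ((2 * b) ^ p) * ENNReal.ofReal (|a - 1| ^ p) +
            ENNReal.ofReal (|F - I| ^ p)) ∂(chain (K.step n N) N (χ, x)) := by
          refine lintegral_mono fun X => (ENNReal.ofReal_le_ofReal (Real.rpow_le_rpow (abs_nonneg _)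
            (abs_sub_le_of_ratio ha' hFa) hp.le)).trans
              (hsplit _ _ _ (abs_nonneg _) (abs_nonneg _) (abs_nonneg _))
      _ ≤ _ := by
          rw [lintegral_const_mul _ (by fun_prop), lintegral_add_right _ (by fun_prop),
            lintegral_add_right _ (by fun_prop), lintegral_const, lintegral_const, measure_univ,
            mul_one, mul_one]
          gcongr

/-- The `p`-th moments of the errors, for every inference time. -/
theorem exists_lintegral_samplesLaw_error_le
    (hZ : ∀ n, 1 ≤ n → n ≤ M →
      0 < evidence m y (τ.time n) ∧ evidence m y (τ.time n) < ∞)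
    (hK : K.IsMCMC m y M) (hA : AssumptionA K m y M) {p : ℝ} (hp : 0 < p)
    (n : ℕ) (hn : 1 ≤ n) (hnM : n ≤ M) :
    ∃ C : ℝ, 0 ≤ C ∧ ∀ N : ℕ, 1 ≤ N → ∀ (x₁ : State τ 1) (f : State τ n → ℝ) (b : ℝ),
      Measurable f → 0 < b → (∀ x, |f x| ≤ b) →
        ∫⁻ X, ENNReal.ofReal (|(1 / (N : ℝ)) * ∑ i, f (X i) - ∫ x, f x ∂(posterior m y τ n)| ^ p)
          ∂(samplesLaw K m N x₁ n) ≤ ENNReal.ofReal (C * (b / √N) ^ p) := by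
  induction n, hn using Nat.le_induction with
  | base =>
    obtain ⟨ε, hε, -, κ, hκ, hmin⟩ := hA.minorization_first hnM
    have := isProbabilityMeasure_posterior (hZ 1 le_rfl hnM).1 (hZ 1 le_rfl hnM).2
    have := K.isMarkovKernel_first
    refine ⟨2 * Real.exp 2 * p ^ p * (2 / ε) ^ p, by positivity, fun N hN x₁ f b hf hb hfb => ?_⟩
    have hinv : ((K.first.comap Prod.snd measurable_snd :
        Kernel (Unit × State τ 1) (State τ 1)).sectR ()).Invariant (posterior m y τ 1) :=
      hK.first hnM
    exact lintegral_chain_average_le () hε hmin hinv hp hf hb hfb hN x₁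
  | succ n hn ih =>
    obtain ⟨C, hC, ih⟩ := ih (Nat.le_of_succ_le hnM)
    obtain ⟨ε, hε, -, κ, hκ, hmin⟩ := hA.minorization_step n hn hnM
    obtain ⟨h0, h1⟩ := hZ n hn (Nat.le_of_succ_le hnM)
    obtain ⟨h0', h1'⟩ := hZ (n + 1) (Nat.le_succ_of_le hn) hnM
    have hw := hA.weight n hn hnM
    set c := ⨆ x : State τ n, ∫⁻ x', filteringWeight m y τ n (x, x')
      ∂(Config.lebesgue (τ.time n) (τ.time (n + 1))) with hc
    have hle : ∀ x, filteringKernel m y τ n x Set.univ ≤ c := fun x => by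
      rw [filteringKernel_univ]
      exact le_iSup (fun x : State τ n => ∫⁻ x', filteringWeight m y τ n (x, x')
        ∂(Config.lebesgue (τ.time n) (τ.time (n + 1)))) x
    have hfin := isFiniteKernel_filteringKernel hw hle
    set B := c.toReal + 1 with hB
    have hB0 : 0 < B := by positivity
    have hone : ∀ x, filteringOperator m y τ n (fun _ => 1) x ≤ B := fun x => by
      rw [filteringOperator_one]
      have : (filteringKernel m y τ n x).real Set.univ ≤ c.toReal :=
        ENNReal.toReal_mono hw.ne (hle x)
      linarith
    have hone' : ∀ x, |filteringOperator m y τ n (fun _ => 1) x| ≤ B := fun x => by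
      rw [abs_of_nonneg (by rw [filteringOperator_one]; positivity)]
      exact hone x
    refine ⟨3 ^ p * (2 * Real.exp 2 * p ^ p * (2 / ε) ^ p + 2 ^ p * C * B ^ p + C * B ^ p),
      by positivity, fun N hN x₁ f b hf hb hfb => ?_⟩
    have hfB : ∀ x, |filteringOperator m y τ n f x| ≤ b * B := fun x =>
      (abs_filteringOperator_le hfb x).trans (by gcongr; exact hone x)
    have hm1 : Measurable (filteringOperator m y τ n fun _ => 1) :=
      measurable_filteringOperator measurable_const
    have hmf : Measurable (filteringOperator m y τ n f) := measurable_filteringOperator hf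
    have e1 := ih N hN x₁ _ B hm1 hB0 hone'
    have e2 := ih N hN x₁ _ (b * B) hmf (by positivity) hfB
    have hmass := samplesLaw_univ_le_one (K := K) (m := m) hN x₁ n
    have hlaw : samplesLaw K m N x₁ (n + 1) =
        (samplesLaw K m N x₁ n).bind (samplesGiven K m n N) := by
      obtain ⟨k, rfl⟩ : ∃ k, n = k + 1 := ⟨n - 1, by omega⟩
      rfl
    have hφ : Measurable fun X : Fin N → State τ (n + 1) => ENNReal.ofReal
        (|(1 / (N : ℝ)) * ∑ i, f (X i) - ∫ x, f x ∂(posterior m y τ (n + 1))| ^ p) := by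
      fun_prop
    rw [hlaw, Measure.lintegral_bind (Kernel.aemeasurable _) hφ.aemeasurable]
    calc _ ≤ _ := lintegral_mono fun χ => lintegral_samplesGiven_error_le hn hN h0 h1 h0' h1' χ
          (hK.step n hn hnM N hN χ) hε (hmin N hN χ) hp hf hb hfb
      _ ≤ ENNReal.ofReal (3 ^ p) *
          (ENNReal.ofReal (2 * Real.exp 2 * p ^ p * (2 / ε) ^ p * (b / √N) ^ p) +
            ENNReal.ofReal ((2 * b) ^ p) * ENNReal.ofReal (C * (B / √N) ^ p) +
            ENNReal.ofReal (C * (b * B / √N) ^ p)) := by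
          rw [lintegral_const_mul _ (by fun_prop), lintegral_add_right _ (by fun_prop),
            lintegral_add_right _ (by fun_prop), lintegral_const,
            lintegral_const_mul _ (by fun_prop)]
          gcongr
          exact mul_le_of_le_one_right' hmass
      _ = _ := by
          rw [← ENNReal.ofReal_mul (by positivity),
            ← ENNReal.ofReal_add (by positivity) (by positivity),
            ← ENNReal.ofReal_add (by positivity) (by positivity),
            ← ENNReal.ofReal_mul (by positivity)]
          congr 1
          have hs : 0 ≤ √(N : ℝ) := Real.sqrt_nonneg _
          rw [Real.div_rpow hb.le hs, Real.div_rpow hB0.le hs,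
            Real.div_rpow (by positivity) hs, Real.mul_rpow hb.le hB0.le,
            Real.mul_rpow (by norm_num) hb.le]
          ring

end Error

end PPFilter

theorem proposition1 (m : PPFilter.CoxModel) (y : PPFilter.Observations)
    (τ : PPFilter.InferenceTimes) (M : ℕ) (hM : τ.time M ≤ y.T)
    (hZ : ∀ n, 1 ≤ n → n ≤ M →
      0 < PPFilter.evidence m y (τ.time n) ∧ PPFilter.evidence m y (τ.time n) < ∞)
    (K : PPFilter.TransitionKernels τ) (hK : K.IsMCMC m y M)
    (hA : PPFilter.AssumptionA K m y M)
    (n : ℕ) (hn : 1 ≤ n) (hnM : n ≤ M) (p : ℝ) (hp : 1 ≤ p) :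
    ∃ B : ℝ, ∀ (N : ℕ), 1 ≤ N → ∀ (x₁ : PPFilter.State τ 1) (f : PPFilter.State τ n → ℝ),
      Measurable f → BddAbove (Set.range fun x => |f x|) →
        (∫ X, |(1 / (N : ℝ)) * ∑ i, f (X i) - ∫ x, f x ∂(PPFilter.posterior m y τ n)| ^ p
            ∂(PPFilter.samplesLaw K m N x₁ n)) ^ (1 / p)
          ≤ B * (⨆ x, |f x|) / Real.sqrt N := by
  have hp0 : 0 < p := one_pos.trans_le hp
  obtain ⟨C, hC, h⟩ := PPFilter.exists_lintegral_samplesLaw_error_le hZ hK hA hp0 n hn hnM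
  refine ⟨C ^ (1 / p), fun N hN x₁ f hf hbdd => ?_⟩
  have hfb : ∀ x, |f x| ≤ ⨆ x, |f x| := fun x => le_ciSup hbdd x
  have hb : 0 ≤ ⨆ x, |f x| := Real.iSup_nonneg fun x => abs_nonneg _
  set b := ⨆ x, |f x|
  rcases hb.eq_or_lt with hb0 | hb0
  · have hf0 : ∀ x, f x = 0 := fun x => abs_eq_zero.1 (le_antisymm (hb0 ▸ hfb x) (abs_nonneg _))
    simp [hf0, Real.zero_rpow hp0.ne', Real.zero_rpow (inv_ne_zero hp0.ne'), ← hb0]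
  · have hint : ∫ X, |(1 / (N : ℝ)) * ∑ i, f (X i) - ∫ x, f x ∂(PPFilter.posterior m y τ n)| ^ p
        ∂(PPFilter.samplesLaw K m N x₁ n) ≤ C * (b / √N) ^ p := by
      rw [integral_eq_lintegral_of_nonneg_ae (.of_forall fun X => by positivity)
        (Measurable.aestronglyMeasurable (by fun_prop))]
      exact ENNReal.toReal_le_of_le_ofReal (by positivity) (h N hN x₁ f b hf hb0 hfb)
    calc _ ≤ (C * (b / √N) ^ p) ^ (1 / p) :=
          Real.rpow_le_rpow (integral_nonneg fun X => by positivity) hint (by positivity)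
      _ = C ^ (1 / p) * b / √N := by
          rw [Real.mul_rpow hC (by positivity), ← Real.rpow_mul (by positivity),
            mul_one_div_cancel hp0.ne', Real.rpow_one, mul_div_assoc]
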